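/- Let $f:\mathbb R^{n_1}\to\mathbb R\cup\{+\infty\}$, $g:\mathbb R^{n_2}\to\mathbb R\cup\{+\infty\}$, let $A:\mathbb R^{n_1}\to\mathbb R^p$, $B:\mathbb R^{n_2}\to\mathbb R^p$ be linear and $c\in\mathbb R^p$. Consider $\min f(x)+g(z)$ subject to $Ax-Bz=c$. Put $\varphi_1(w)=\inf\{f(x): Ax=w\}$ and $\varphi_2(w)=\inf\{g(z): Bz=w-c\}$ (with $\inf\emptyset=+\infty$), and for $\gamma>0$ let $\operatorname{prox}_{\gamma\varphi}(s)=\operatorname{argmin}_w\,\varphi(w)+\frac1{2\gamma}\|w-s\|^2$ (a set). Assume: (A.1) $\varphi_1$ is differentiable, $\|\nabla\varphi_1(x)-\nabla\varphi_1(y)\|\le L\|x-y\|$ and $\langle\nabla\varphi_1(x)-\nabla\varphi_1(y),x-y\rangle\ge\sigma\|x-y\|^2$ for all $x,y$, with $\sigma\in[-L,L]$; (A.2) $\varphi_2$ is lower semicontinuous and proper; (A.3) $\varphi_1+\varphi_2$ has a global minimizer; (B.2) every sublevel set $\{\varphi_1+\varphi_2\le\alpha\}$, $\alpha\in\mathbb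 R$, is bounded; (B.3) $0<\gamma<\min\{\frac1{2\max\{-\sigma,0\}},\frac1L\}$ (with $1/0=\infty$); (C.1) $\nu_1>0$ and $\nu_2>0$. For $s\in\mathbb R^p$ let $u(s)$ be the unique element of $\operatorname{prox}_{\gamma\varphi_1}(s)$ and let $$\psi(s)=\inf_w\Big(\varphi_1(u(s))+\varphi_2(w)+\langle\nabla\varphi_1(u(s)),w-u(s)\rangle+\tfrac1{2\gamma}\|w-u(s)\|^2\Big)$$ be the Douglas–Rachford envelope. Fix $m\in\mathbb N$. Let $(s_k,u_k,v_k)_{k\ge0}$ be generated by Anderson-accelerated Douglas–Rachford splitting, run without early termination: $s_0\in\mathbb R^p$ is arbitrary and, for every $k\ge0$, $$x_k\in\operatorname{argmin}_x f(x)+\tfrac1{2\gamma}\|Ax-s_k\|^2,\quad u_k=Ax_k,\quad z_k\in\operatorname{argmin}_z g(z)+\tfrac1{2\gamma}\|Bz+c-(2u_k-s_k)\|^2,\quad v_k=Bz_k+c.$$ With $g_k=s_k+v_k-u_k$, $r_k=v_k-u_k$ and $\bar m=\min(m,k)$, let $s^{AA}_k=g_k-\sum_{j=1}^{\bar m}\theta_j^*(g_{k-j+1}-g_{k-j})$,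 where $(\theta^*_j)$ minimizes $\|r_k-\sum_{j=1}^{\bar m}\theta_j(r_{k-j+1}-r_{k-j})\|^2$. Then $s_{k+1}=s^{AA}_k$ if $$\psi(s^{AA}_k)-\psi(s_k)\le-\nu_1\|g_k-s_k\|^2-\nu_2\|s^{AA}_k-s_k\|^2,$$ and $s_{k+1}=g_k$ otherwise. Let $\mathfrak D(s,u,v)=\varphi_1(u)+\varphi_2(v)+\frac1\gamma\langle s-u,v-u\rangle+\frac1{2\gamma}\|v-u\|^2$ on $\mathbb R^{3p}$, and let $\mathcal U$ be the set of cluster points of $(s_k,u_k,v_k)$. Suppose that for some $\theta\in(0,\frac12]$ the function $\mathfrak D$ has the Kurdyka–Łojasiewicz property with exponent $\theta$ at every $\bar t\in\mathcal U$, i.e. $\partial\mathfrak D(\bar t)\neq\emptyset$ and there are $\eta\in(0,\infty]$, a neighbourhood $U$ of $\bar t$ and $q>0$ such that, with $\rho(\tau)=q\tau^{1-\theta}$, $\rho'(\mathfrak D(t)-\mathfrak D(\bar t))\cdot\operatorname{dist}(0,\partial\mathfrak D(t))\ge1$ for all $t\in U$ with $0<\mathfrak D(t)-\mathfrak D(\bar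 t)<\eta$. Here $\partial$ is the limiting subdifferential and $\operatorname{dist}(0,\emptyset)=+\infty$. Say that $a_k\to a$ r-linearly if there are $C$ and $r\in(0,1)$ with $\|a_k-a\|\le Cr^k$ for all $k$. Then $\|v_k-u_k\|\to0$ r-linearly, and there are $s^*,u^*\in\mathbb R^p$ such that $s_k\to s^*$, $u_k\to u^*$ and $v_k\to u^*$ r-linearly. Moreover $s^*$ is a fixed point of the Douglas–Rachford map, i.e. $s^*=s^*+v-u$ for some $u\in\operatorname{prox}_{\gamma\varphi_1}(s^*)$ and $v\in\operatorname{prox}_{\gamma\varphi_2}(2u-s^*)$, and $\operatorname{prox}_{\gamma\varphi_1}(s^*)=\{u^*\}$. -/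

import Mathlib

open Filter Topology

namespace AADR

section General

variable {E : Type*} [NormedAddCommGroup E] [InnerProductSpace ℝ E]

/-- The set of global minimizers of an extended-real-valued function. -/
def argminSet {α : Type*} (F : α → EReal) : Set α :=
  {x | ∀ y, F x ≤ F y}

/-- Proper: never `-∞`, and not identically `+∞`. -/
def IsProper {α : Type*} (F : α → EReal) : Prop :=
  (∀ x, F x ≠ ⊥) ∧ ∃ x, F x ≠ ⊤

/-- Level-bounded: every sublevel set at a real level is bounded. -/
def LevelBounded (F : E → EReal) : Prop :=
  ∀ α : ℝ, Bornology.IsBounded {x | F x ≤ (α : EReal)}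

/-- The gradient of an extended-real-valued function, meaningful where the function is finite and
differentiable. -/
noncomputable def egradient [CompleteSpace E] (F : E → EReal) (x : E) : E :=
  gradient (fun y => (F y).toReal) x

/-- Differentiable on the whole space; in particular finite everywhere. -/
def EDifferentiable (F : E → EReal) : Prop :=
  (∀ x, F x ≠ ⊥ ∧ F x ≠ ⊤) ∧ Differentiable ℝ (fun x => (F x).toReal)

/-- `L`-smooth: differentiable with `L`-Lipschitz gradient. -/
def LSmooth [CompleteSpace E] (L : ℝ) (F : E → EReal) : Prop :=
  EDifferentiable F ∧ ∀ x y, ‖egradient F x - egradient F y‖ ≤ L * ‖x - y‖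

/-- `σ`-hypoconvex: differentiable with `⟨∇F x - ∇F y, x - y⟩ ≥ σ ‖x - y‖²`. -/
def Hypoconvex [CompleteSpace E] (σ : ℝ) (F : E → EReal) : Prop :=
  EDifferentiable F ∧
    ∀ x y, σ * ‖x - y‖ ^ 2 ≤ inner ℝ (egradient F x - egradient F y) (x - y)

/-- The (set-valued) proximal mapping of `γ F`, for `γ > 0`. -/
def proxMap (γ : ℝ) (F : E → EReal) (s : E) : Set E :=
  argminSet fun y => F y + ((1 / (2 * γ) * ‖y - s‖ ^ 2 : ℝ) : EReal)

/-- The image function `f_A`: `y ↦ inf {f x | A x = y}`, which is `+∞` outside the range of `A`. -/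
noncomputable def imageFun {X : Type*} [AddCommGroup X] [Module ℝ X] (A : X →ₗ[ℝ] E)
    (f : X → EReal) (y : E) : EReal :=
  ⨅ (x : X) (_ : A x = y), f x

/-- Regular (Fréchet) subgradients of `F` at `x`: `F` is finite at `x` and
`F y ≥ F x + ⟨ξ, y - x⟩ + o(‖y - x‖)` as `y → x`. -/
def regularSubdiff (F : E → EReal) (x : E) : Set E :=
  {ξ | F x ≠ ⊥ ∧ F x ≠ ⊤ ∧ ∀ ε : ℝ, 0 < ε →
    ∀ᶠ y in 𝓝 x, F x + ((inner ℝ ξ (y - x) - ε * ‖y - x‖ : ℝ) : EReal) ≤ F y}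

/-- General (limiting) subgradients of `F` at `x`: `F` is finite at `x` and `ξ = lim ξ_i` with `ξ_i`
a regular subgradient at `x_i`, where `x_i → x` and `F x_i → F x`. -/
def limitingSubdiff (F : E → EReal) (x : E) : Set E :=
  {ξ | F x ≠ ⊥ ∧ F x ≠ ⊤ ∧ ∃ (y : ℕ → E) (η : ℕ → E),
    (∀ i, η i ∈ regularSubdiff F (y i)) ∧ Tendsto y atTop (𝓝 x) ∧
      Tendsto (fun i => F (y i)) atTop (𝓝 (F x)) ∧ Tendsto η atTop (𝓝 ξ)}

/-- The Kurdyka-Łojasiewicz inequality `ρ'(ψ x - ψ x₀) · dist(0, ∂ψ x) ≥ 1` on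
`U ∩ {x | 0 < ψ x - ψ x₀ < η}`; the distance to the empty set is `+∞`. -/
def KLInequality (ψ : E → EReal) (x₀ : E) (ρ : ℝ → ℝ) (U : Set E) (η : EReal) : Prop :=
  ∀ x ∈ U, 0 < ψ x - ψ x₀ → ψ x - ψ x₀ < η →
    1 ≤ ENNReal.ofReal (deriv ρ (ψ x - ψ x₀).toReal) * Metric.infEDist 0 (limitingSubdiff ψ x)

/-- The Kurdyka-Łojasiewicz property at `x₀ ∈ dom ∂ψ` with exponent `θ`, that is, with a
desingularizing function `ρ t = q t ^ (1 - θ)`, `q > 0`. -/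
def HasKLExponentAt (ψ : E → EReal) (x₀ : E) (θ : ℝ) : Prop :=
  (limitingSubdiff ψ x₀).Nonempty ∧
    ∃ η : EReal, 0 < η ∧ ∃ U ∈ 𝓝 x₀, ∃ q : ℝ, 0 < q ∧
      KLInequality ψ x₀ (fun t => q * t ^ (1 - θ)) U η

/-- `a k → l` r-linearly: the errors are dominated by a geometric sequence with ratio `< 1`. -/
def RLinearlyConvergesTo {F : Type*} [NormedAddCommGroup F] (a : ℕ → F) (l : F) : Prop :=
  ∃ C r : ℝ, 0 < r ∧ r < 1 ∧ ∀ k, ‖a k - l‖ ≤ C * r ^ k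

/-- The Douglas-Rachford envelope
`min_w φ₁(u) + φ₂(w) + ⟨∇φ₁(u), w - u⟩ + ‖w - u‖² / (2γ)` at `u = u(s) = prox_{γφ₁}(s)`.
The infimum over `u` only names `u(s)`: for `φ₁` that is `L`-smooth with `γ L < 1` the set
`proxMap γ φ₁ s` has exactly one element. -/
noncomputable def drEnvelope [CompleteSpace E] (γ : ℝ) (φ₁ φ₂ : E → EReal) (s : E) : EReal :=
  ⨅ u ∈ proxMap γ φ₁ s, ⨅ w : E,
    φ₁ u + φ₂ w + ((inner ℝ (egradient φ₁ u) (w - u) + 1 / (2 * γ) * ‖w - u‖ ^ 2 : ℝ) : EReal)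

/-- The (set-valued) Douglas-Rachford map `𝒢`: `s + v - u` for `u ∈ prox_{γφ₁}(s)` and
`v ∈ prox_{γφ₂}(2u - s)`. -/
def drMap (γ : ℝ) (φ₁ φ₂ : E → EReal) (s : E) : Set E :=
  {t | ∃ u ∈ proxMap γ φ₁ s, ∃ v ∈ proxMap γ φ₂ ((2 : ℝ) • u - s), t = s + v - u}

/-- The function `𝔇(s, u, v) = φ₁(u) + φ₂(v) + ⟨s - u, v - u⟩ / γ + ‖v - u‖² / (2γ)` on the
Euclidean product `E × E × E`. -/
noncomputable def drLyapunov (γ : ℝ) (φ₁ φ₂ : E → EReal)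
    (t : PiLp 2 (fun _ : Fin 3 => E)) : EReal :=
  φ₁ (t 1) + φ₂ (t 2) +
    ((1 / γ * inner ℝ (t 0 - t 1) (t 2 - t 1) + 1 / (2 * γ) * ‖t 2 - t 1‖ ^ 2 : ℝ) : EReal)

/-- `t` is an Anderson-accelerated iterate with window `m` at step `k`, computed from the images
`g j` and the residuals `r j`, `j ≤ k`: for some minimizer `θ` of
`‖r_k - ∑_{j=1}^{m'} θ_j (r_{k-j+1} - r_{k-j})‖²`, where `m' = min m k`,
`t = g_k - ∑_{j=1}^{m'} θ_j (g_{k-j+1} - g_{k-j})`. The index `j : Fin m'` stands for `j + 1`. -/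
def IsAndersonIterate (m : ℕ) (g r : ℕ → E) (k : ℕ) (t : E) : Prop :=
  ∃ θ : Fin (min m k) → ℝ,
    (∀ θ' : Fin (min m k) → ℝ,
      ‖r k - ∑ j, θ j • (r (k - j) - r (k - (j + 1)))‖ ^ 2 ≤
        ‖r k - ∑ j, θ' j • (r (k - j) - r (k - (j + 1)))‖ ^ 2) ∧
    t = g k - ∑ j, θ j • (g (k - j) - g (k - (j + 1)))

end General

/-- The sequences generated by Anderson-accelerated ADMM, based on Douglas-Rachford splitting with
the envelope as merit function, for `min f x + g z` subject to `A x - B z = c`, with `γ = 1 / β` and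
without early termination. The initial `s 0` is arbitrary; `s k`, `u k`, `v k`, `x k`, `z k` belong
to the `k`-th iterate that is kept, and `sAA k` is the accelerated candidate for iterate `k + 1`. -/
structure IsAARun {X Z E : Type*} [AddCommGroup X] [Module ℝ X] [AddCommGroup Z] [Module ℝ Z]
    [NormedAddCommGroup E] [InnerProductSpace ℝ E] [CompleteSpace E]
    (f : X → EReal) (g : Z → EReal) (A : X →ₗ[ℝ] E) (B : Z →ₗ[ℝ] E) (c : E)
    (γ ν₁ ν₂ : ℝ) (m : ℕ) (s u v sAA : ℕ → E) (x : ℕ → X) (z : ℕ → Z) : Prop where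
  x_mem : ∀ k, x k ∈ argminSet fun x' =>
    f x' + ((1 / (2 * γ) * ‖A x' - s k‖ ^ 2 : ℝ) : EReal)
  u_eq : ∀ k, u k = A (x k)
  z_mem : ∀ k, z k ∈ argminSet fun z' =>
    g z' + ((1 / (2 * γ) * ‖B z' + c - ((2 : ℝ) • u k - s k)‖ ^ 2 : ℝ) : EReal)
  v_eq : ∀ k, v k = B (z k) + c
  anderson : ∀ k, IsAndersonIterate m (fun i => s i + v i - u i) (fun i => v i - u i) k (sAA k)
  accept : ∀ k,
    drEnvelope γ (imageFun A f) (fun w => imageFun B g (w - c)) (sAA k)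
        - drEnvelope γ (imageFun A f) (fun w => imageFun B g (w - c)) (s k)
      ≤ ((-ν₁ * ‖(s k + v k - u k) - s k‖ ^ 2 - ν₂ * ‖sAA k - s k‖ ^ 2 : ℝ) : EReal) →
    s (k + 1) = sAA k
  reject : ∀ k,
    ¬ (drEnvelope γ (imageFun A f) (fun w => imageFun B g (w - c)) (sAA k)
        - drEnvelope γ (imageFun A f) (fun w => imageFun B g (w - c)) (s k)
      ≤ ((-ν₁ * ‖(s k + v k - u k) - s k‖ ^ 2 - ν₂ * ‖sAA k - s k‖ ^ 2 : ℝ) : EReal)) →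
    s (k + 1) = s k + v k - u k

end AADR

/-!
Write `φ = φ₁` (real-valued), `r_k = v_k - u_k`, and let `Ψ_k` be the value of the Douglas-Rachford
envelope at `s_k`. Stationarity of the first proximal step reads `s_k = u_k + γ∇φ(u_k)`
(`mem_proxMap_coe_iff`), so that `Ψ_k = 𝔇(s_k, u_k, v_k)` (`drEnvelope_eq`, `drLyapunov_eq`). Three
facts give the rate.

* Sufficient decrease: `κ (‖r_k‖² + ‖s_{k+1} - s_k‖²) ≤ Ψ_k - Ψ_{k+1}` (`IsAARun.exists_decrease`).
  At an accelerated step this is the acceptance test, so the choice of the Anderson coefficients is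
  immaterial. At a plain step it is the decrease of the envelope along Douglas-Rachford splitting
  (`exists_mul_norm_sq_le_envelopeModel_sub`), which rests on the interpolation inequality for
  smooth hypoconvex functions (`bregman_ge`).
* Relative error: `(r_k / γ, -2 r_k / γ, 0)` is a subgradient of `𝔇` at `(s_k, u_k, v_k)`
  (`mem_regularSubdiff_drLyapunov`).
* The Kurdyka-Łojasiewicz inequality: since `θ ≤ 1/2`, it bounds `Ψ_k - lim Ψ` by a multiple of
  the squared norm of any subgradient near a cluster point
  (`HasKLExponentAt.exists_sub_le_mul_sq`). Level-boundedness keeps the triples in a compact set,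
  and `𝔇 = lim Ψ` at every cluster point (`drLyapunov_eq_of_tendsto`), so one constant serves for
  all large `k` (`exists_eventually_le_of_mapClusterPt`).

Together, `Ψ_k - lim Ψ ≤ C (Ψ_k - Ψ_{k+1})` eventually, hence `Ψ_k - lim Ψ` decays geometrically, and
by sufficient decrease so do `‖r_k‖` and the steps `‖s_{k+1} - s_k‖`. The limits satisfy
`s' = u' + γ∇φ(u')` by continuity and `u' ∈ prox_{γφ₂}(2u' - s')` by lower semicontinuity
(`mem_proxMap_of_tendsto`).
-/

open Filter Topology

namespace AADR

/-! ### Quadratic bounds for smooth hypoconvex functions -/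

section Smooth

variable {E : Type*} [NormedAddCommGroup E] [InnerProductSpace ℝ E] [CompleteSpace E]

/-- The descent lemma, from a one-sided Lipschitz condition on the gradient. -/
theorem le_add_inner_add_sq_of_gradient {φ : E → ℝ} {G : E → E} {L : ℝ}
    (hG : ∀ x, HasGradientAt φ (G x) x)
    (hL : ∀ x y, inner ℝ (G x - G y) (x - y) ≤ L * ‖x - y‖ ^ 2) (x y : E) :
    φ y ≤ φ x + inner ℝ (G x) (y - x) + L / 2 * ‖y - x‖ ^ 2 := by
  set d := y - x with hd
  let h : ℝ → ℝ := fun t => φ (x + t • d) - t * inner ℝ (G x) d - L / 2 * t ^ 2 * ‖d‖ ^ 2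
  have hder : ∀ t : ℝ, HasDerivAt h
      (inner ℝ (G (x + t • d)) d - inner ℝ (G x) d - L * t * ‖d‖ ^ 2) t := by
    intro t
    have h1 : HasDerivAt (fun t : ℝ => x + t • d) d t := by
      simpa using ((hasDerivAt_id t).smul_const d).const_add x
    have h2 := (hG (x + t • d)).hasFDerivAt.comp_hasDerivAt t h1
    have h3 := (hasDerivAt_id t).mul_const (inner ℝ (G x) d)
    have h4 := (((hasDerivAt_id t).pow 2).const_mul (L / 2)).mul_const (‖d‖ ^ 2)
    refine ((h2.sub h3).sub h4).congr_deriv ?_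
    simp only [InnerProductSpace.toDual_apply_apply, Nat.cast_ofNat, id_eq, Nat.add_one_sub_one,
      pow_one, mul_one, one_mul]
    ring
  have hanti : AntitoneOn h (Set.Icc 0 1) := by
    refine antitoneOn_of_deriv_nonpos (convex_Icc 0 1)
      (fun t _ => (hder t).continuousAt.continuousWithinAt)
      (fun t _ => (hder t).differentiableAt.differentiableWithinAt) fun t ht => ?_
    rw [interior_Icc] at ht
    rw [(hder t).deriv]
    have h5 := hL (x + t • d) x
    rw [add_sub_cancel_left, inner_smul_right, inner_sub_left, norm_smul, mul_pow,
      Real.norm_eq_abs, sq_abs] at h5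
    have h6 : t * (inner ℝ (G (x + t • d)) d - inner ℝ (G x) d - L * t * ‖d‖ ^ 2) ≤ 0 := by
      linarith
    exact nonpos_of_mul_nonpos_right h6 ht.1
  have h7 := hanti (Set.left_mem_Icc.2 zero_le_one) (Set.right_mem_Icc.2 zero_le_one) zero_le_one
  simp only [h, one_smul, zero_smul, add_zero] at h7
  rw [show x + d = y by simp [hd]] at h7
  linarith

/-- The quadratic lower bound of a hypoconvex function. -/
theorem add_inner_add_sq_le_of_gradient {φ : E → ℝ} {G : E → E} {σ : ℝ}
    (hG : ∀ x, HasGradientAt φ (G x) x)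
    (hσ : ∀ x y, σ * ‖x - y‖ ^ 2 ≤ inner ℝ (G x - G y) (x - y)) (x y : E) :
    φ x + inner ℝ (G x) (y - x) + σ / 2 * ‖y - x‖ ^ 2 ≤ φ y := by
  have hG' : ∀ x, HasGradientAt (fun x => -φ x) (-G x) x := fun x => by
    rw [hasGradientAt_iff_hasFDerivAt, map_neg]
    exact (hG x).hasFDerivAt.neg
  have := le_add_inner_add_sq_of_gradient (φ := fun x => -φ x) (G := fun x => -G x) (L := -σ) hG'
    (fun x y => by
      have := hσ x y
      rw [neg_sub_neg, ← neg_sub (G x), inner_neg_left]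
      linarith) x y
  rw [inner_neg_left] at this
  linarith

/-- The interpolation inequality of smooth hypoconvex functions: the Bregman distance dominates
the square of the gradient difference. It follows by comparing the upper quadratic bound at `x`
with the lower one at `y`, both at a gradient step from `x`. -/
theorem bregman_ge {φ : E → ℝ} {G : E → E} {σ L : ℝ} (hσL : σ < L)
    (hG : ∀ x, HasGradientAt φ (G x) x)
    (hσ : ∀ x y, σ * ‖x - y‖ ^ 2 ≤ inner ℝ (G x - G y) (x - y))
    (hL : ∀ x y, inner ℝ (G x - G y) (x - y) ≤ L * ‖x - y‖ ^ 2) (x y : E) :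
    σ / 2 * ‖x - y‖ ^ 2 + 1 / (2 * (L - σ)) * ‖G x - G y - σ • (x - y)‖ ^ 2 ≤
      φ x - φ y - inner ℝ (G y) (x - y) := by
  have hℓ : 0 < L - σ := sub_pos.2 hσL
  set e := G x - G y with he
  set d := x - y with hd
  set a := e - σ • d with ha
  set τ := 1 / (L - σ) with hτ
  have hτℓ : τ * (L - σ) = 1 := by rw [hτ]; field_simp
  have h1 := le_add_inner_add_sq_of_gradient hG hL x (x - τ • a)
  have h2 := add_inner_add_sq_le_of_gradient hG hσ y (x - τ • a)
  rw [show x - τ • a - x = -(τ • a) by abel] at h1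
  rw [show x - τ • a - y = d - τ • a by rw [hd]; abel] at h2
  have hGx : G x = G y + e := by rw [he]; abel
  have hea : e = a + σ • d := by rw [ha]; abel
  rw [hGx, hea] at h1
  rw [norm_sub_sq_real] at h2
  simp only [norm_neg, norm_smul, inner_neg_right, inner_sub_right, inner_smul_right,
    inner_add_left, inner_smul_left, mul_pow, Real.norm_eq_abs, sq_abs, real_inner_self_eq_norm_sq,
    conj_trivial] at h1 h2
  have h3 : 1 / (2 * (L - σ)) = τ / 2 := by rw [hτ]; field_simp
  rw [h3]
  have h4 : τ ^ 2 * L = τ + τ ^ 2 * σ := by linear_combination τ * hτℓ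
  have h5 : L / 2 * (τ ^ 2 * ‖a‖ ^ 2) = (τ + τ ^ 2 * σ) / 2 * ‖a‖ ^ 2 := by rw [← h4]; ring
  rw [h5] at h1
  linarith

/-- The scalar inequality behind the decrease of the envelope along a Douglas-Rachford step. Here
`a = ‖d‖²`, `P = ⟨e, d⟩`, `N = ‖e‖²` for a displacement `d` and a gradient difference `e`, and `D`
is a Bregman distance. -/
theorem exists_decrease_const {L σ γ : ℝ} (hL : 0 < L) (hσ : σ ≤ 0) (hγ : 0 < γ)
    (hγσ : γ * (2 * -σ) < 1) (hγL : γ * L < 1) :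
    ∃ c : ℝ, 0 < c ∧ ∀ a P N D : ℝ, 0 ≤ a → σ * a ≤ P → P ≤ L * a → N ≤ L ^ 2 * a →
      N - 2 * σ * P + σ ^ 2 * a ≤ (L - σ) * (P - σ * a) →
      σ / 2 * a ≤ D →
      σ / 2 * a + 1 / (2 * (L - σ)) * (N - 2 * σ * P + σ ^ 2 * a) ≤ D →
      c * a ≤ D + 1 / (2 * γ) * a - γ * N := by
  have hℓ : 0 < L - σ := by linarith
  set g := 1 / (2 * γ) with hg
  have hgγ : g * γ = 1 / 2 := by rw [hg]; field_simp
  have hg0 : 0 < g := by positivity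
  set τ := 1 / (2 * (L - σ)) with hτ
  have hτℓ : τ * (L - σ) = 1 / 2 := by rw [hτ]; field_simp
  have hτ0 : 0 < τ := by positivity
  have hgL : L / 2 < g := by nlinarith
  have hgσ : -σ < g := by nlinarith
  rcases le_or_gt γ τ with hc | hc
  -- for such small steps the quadratic lower bound on `D` and `N ≤ L ^ 2 * a` suffice
  · refine ⟨σ / 2 + g - γ * L ^ 2, ?_, ?_⟩
    · have : L - σ ≤ g := by nlinarith
      have h1 : γ * L ≤ 1 / 2 := by nlinarith
      nlinarith
    · intro a P N D ha h1 h2 h3 h4 h5 h6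
      nlinarith [mul_le_mul_of_nonneg_left h3 hγ.le]
  -- here the total coefficient `τ - γ` of `N` is negative, and cocoercivity bounds `N` from above
  · set c₁ := σ / 2 + g - γ * σ ^ 2 with hc₁
    set c₂ := L / 2 + g - γ * L ^ 2 with hc₂
    have hc₁0 : 0 < c₁ := by nlinarith
    have hc₂0 : 0 < c₂ := by nlinarith
    refine ⟨min c₁ c₂, lt_min hc₁0 hc₂0, ?_⟩
    intro a P N D ha h1 h2 h3 h4 h5 h6
    have h7 : N ≤ (L + σ) * P - σ * L * a := by nlinarith
    have h8 := mul_le_mul_of_nonneg_left h7 (sub_pos.2 hc).le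
    -- the lower bound is affine in `P`, hence a convex combination of its values at `σ a`, `L a`
    have h9 : (L - σ) * (σ / 2 * a + τ * (-(2 * σ * P) + σ ^ 2 * a) + g * a
        - (γ - τ) * ((L + σ) * P - σ * L * a)) = (L * a - P) * c₁ + (P - σ * a) * c₂ := by
      rw [hc₁, hc₂]
      linear_combination (L * P - L * σ * a + σ ^ 2 * a - σ * P) * hτℓ
    have h10 : (L * a - P) * min c₁ c₂ ≤ (L * a - P) * c₁ :=
      mul_le_mul_of_nonneg_left (min_le_left _ _) (by linarith)
    have h11 : (P - σ * a) * min c₁ c₂ ≤ (P - σ * a) * c₂ :=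
      mul_le_mul_of_nonneg_left (min_le_right _ _) (by linarith)
    have h12 : (L - σ) * (min c₁ c₂ * a) ≤ (L - σ) * (σ / 2 * a + τ * (-(2 * σ * P) + σ ^ 2 * a)
        + g * a - (γ - τ) * ((L + σ) * P - σ * L * a)) := by
      rw [h9]; linarith
    have h13 := le_of_mul_le_mul_left h12 hℓ
    linarith

end Smooth

/-! ### Proximal mappings and the Douglas-Rachford envelope -/

section Prox

variable {E : Type*} [NormedAddCommGroup E]

/-- A proximal point of a proper function has a finite value. -/
theorem exists_coe_eq_of_mem_proxMap {γ : ℝ} {F : E → EReal} (hF : IsProper F) {s v : E}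
    (hv : v ∈ proxMap γ F s) : ∃ b : ℝ, F v = b := by
  obtain ⟨hbot, w, hw⟩ := hF
  refine ⟨(F v).toReal, (EReal.coe_toReal (fun h => ?_) (hbot v)).symm⟩
  have h1 := hv w
  simp only [h, EReal.top_add_coe, top_le_iff] at h1
  exact EReal.add_ne_top hw (EReal.coe_ne_top _) h1

theorem le_of_mem_proxMap {γ : ℝ} {F : E → EReal} {s v w : E} {b r : ℝ}
    (hv : v ∈ proxMap γ F s) (hb : F v = b) (hr : F w = r) :
    b + 1 / (2 * γ) * ‖v - s‖ ^ 2 ≤ r + 1 / (2 * γ) * ‖w - s‖ ^ 2 := by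
  have h1 := hv w
  simp only [hb, hr] at h1
  exact_mod_cast h1

variable [InnerProductSpace ℝ E]

/-- Minimizing `f + q ∘ A` over the fibres of `A` minimizes `imageFun A f + q`. -/
theorem imageFun_add_le_of_mem_argminSet {X : Type*} [AddCommGroup X] [Module ℝ X]
    {A : X →ₗ[ℝ] E} {f : X → EReal} {q : E → ℝ} {x : X}
    (hx : x ∈ argminSet fun x' => f x' + (q (A x') : EReal)) (w : E) :
    imageFun A f (A x) + (q (A x) : EReal) ≤ imageFun A f w + (q w : EReal) := by
  have h1 : imageFun A f (A x) ≤ f x := iInf₂_le (f := fun x' (_ : A x' = A x) => f x') x rfl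
  refine (add_le_add_left h1 _).trans ?_
  rw [← EReal.sub_le_iff_le_add (Or.inl (EReal.coe_ne_bot _)) (Or.inl (EReal.coe_ne_top _))]
  refine le_iInf₂ fun x' hx' => ?_
  rw [EReal.sub_le_iff_le_add (Or.inl (EReal.coe_ne_bot _)) (Or.inl (EReal.coe_ne_top _)), ← hx']
  exact hx x'

/-- The proximal mapping of a smooth hypoconvex function is Lipschitz. -/
theorem mul_norm_sub_le_of_hypoconvex {G : E → E} {σ γ : ℝ}
    (hσ : ∀ x y, σ * ‖x - y‖ ^ 2 ≤ inner ℝ (G x - G y) (x - y)) (hγ : 0 < γ) (u u' : E) :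
    (1 + γ * σ) * ‖u - u'‖ ≤ ‖u + γ • G u - (u' + γ • G u')‖ := by
  rcases (norm_nonneg (u - u')).eq_or_lt with h0 | h0
  · rw [← h0, mul_zero]; exact norm_nonneg _
  refine le_of_mul_le_mul_right ?_ h0
  refine le_trans ?_ (real_inner_le_norm _ _)
  rw [show u + γ • G u - (u' + γ • G u') = (u - u') + γ • (G u - G u') by rw [smul_sub]; abel,
    inner_add_left, inner_smul_left, real_inner_self_eq_norm_sq]
  have := mul_le_mul_of_nonneg_left (hσ u u') hγ.le
  simp only [conj_trivial]
  linarith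

/-- The quantity `φ(u) + b + ⟨∇φ(u), v - u⟩ + ‖v - u‖² / (2γ)`, for a gradient `G` of `φ`. With
`b = φ₂(v)` it is the objective minimized over `v` in the Douglas-Rachford envelope. -/
noncomputable def envelopeModel (γ : ℝ) (φ : E → ℝ) (G : E → E) (u v : E) (b : ℝ) : ℝ :=
  φ u + b + inner ℝ (G u) (v - u) + 1 / (2 * γ) * ‖v - u‖ ^ 2

/-- Completing the square turns the minimization over `v` into a proximal step at
`2u - s = u - γ∇φ(u)`. -/
theorem envelopeModel_eq {γ : ℝ} (hγ : 0 < γ) (φ : E → ℝ) (G : E → E) (u v : E) (b : ℝ) :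
    envelopeModel γ φ G u v b =
      φ u + (b + 1 / (2 * γ) * ‖v - ((2 : ℝ) • u - (u + γ • G u))‖ ^ 2) - γ / 2 * ‖G u‖ ^ 2 := by
  rw [show v - ((2 : ℝ) • u - (u + γ • G u)) = (v - u) + γ • G u by rw [two_smul]; abel,
    norm_add_sq_real, inner_smul_right, norm_smul, mul_pow, Real.norm_eq_abs, sq_abs,
    real_inner_comm, envelopeModel]
  field_simp
  ring

theorem drLyapunov_eq {φ : E → ℝ} {G : E → E} {F : E → EReal} {γ : ℝ} (hγ : 0 < γ)
    {s u v : E} {b : ℝ} (hs : s = u + γ • G u) (hb : F v = b) :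
    drLyapunov γ (fun x => (φ x : EReal)) F (WithLp.toLp 2 ![s, u, v]) =
      (envelopeModel γ φ G u v b : EReal) := by
  have h1 : s - u = γ • G u := by rw [hs]; abel
  simp only [drLyapunov, Matrix.cons_val, hb, envelopeModel, h1, inner_smul_left, conj_trivial]
  norm_cast
  field_simp
  ring

variable [CompleteSpace E]

/-- For a differentiable hypoconvex function and a small step, proximal points are exactly the
solutions of the stationarity equation. -/
theorem mem_proxMap_coe_iff {φ : E → ℝ} {G : E → E} {σ γ : ℝ}
    (hG : ∀ x, HasGradientAt φ (G x) x)
    (hσ : ∀ x y, σ * ‖x - y‖ ^ 2 ≤ inner ℝ (G x - G y) (x - y)) (hγ : 0 < γ)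
    (hγσ : 0 < 1 + γ * σ) {s u : E} :
    u ∈ proxMap γ (fun x => (φ x : EReal)) s ↔ s = u + γ • G u := by
  have hreal : u ∈ proxMap γ (fun x => (φ x : EReal)) s ↔
      ∀ y, φ u + 1 / (2 * γ) * ‖u - s‖ ^ 2 ≤ φ y + 1 / (2 * γ) * ‖y - s‖ ^ 2 := by
    refine forall_congr' fun y => ?_
    simp only [← EReal.coe_add, EReal.coe_le_coe_iff]
  rw [hreal]
  constructor
  · intro h
    have hmin : IsLocalMin (fun y => φ y + 1 / (2 * γ) * ‖y - s‖ ^ 2) u :=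
      Filter.Eventually.of_forall h
    have h1 : HasFDerivAt (fun y : E => y - s) (ContinuousLinearMap.id ℝ E) u :=
      (hasFDerivAt_id u).sub_const s
    have h2 := (hG u).hasFDerivAt.add (h1.norm_sq.const_mul (1 / (2 * γ)))
    have h3 := hmin.hasFDerivAt_eq_zero h2
    have h4 : ∀ w, inner ℝ (u + γ • G u - s) w = 0 := fun w => by
      have h5 := DFunLike.congr_fun h3 w
      simp only [_root_.add_apply, InnerProductSpace.toDual_apply_apply,
        _root_.smul_apply, ContinuousLinearMap.comp_apply, innerSL_apply_apply,
        ContinuousLinearMap.id_apply, _root_.zero_apply, smul_eq_mul] at h5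
      rw [show u + γ • G u - s = γ • G u + (u - s) by abel, inner_add_left, inner_smul_left]
      simp only [conj_trivial]
      have h6 : γ * (inner ℝ (G u) w + 1 / (2 * γ) * (2 * inner ℝ (u - s) w)) = 0 := by
        rw [← mul_zero γ, ← h5]; simp
      have h7 : γ * (inner ℝ (G u) w + 1 / (2 * γ) * (2 * inner ℝ (u - s) w))
        = γ * inner ℝ (G u) w + inner ℝ (u - s) w := by field_simp
      linarith
    exact (sub_eq_zero.1 (inner_self_eq_zero.1 (h4 _))).symm
  · rintro rfl y
    have h1 := add_inner_add_sq_le_of_gradient hG hσ u y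
    have h2 : ‖y - (u + γ • G u)‖ ^ 2 =
        ‖y - u‖ ^ 2 - 2 * (γ * inner ℝ (G u) (y - u)) + ‖u - (u + γ • G u)‖ ^ 2 := by
      rw [show y - (u + γ • G u) = (y - u) - γ • G u by abel,
        show u - (u + γ • G u) = -(γ • G u) by abel, norm_sub_sq_real, inner_smul_right,
        norm_neg, real_inner_comm]
    rw [h2]
    have h3 : 1 / (2 * γ) * (‖y - u‖ ^ 2 - 2 * (γ * inner ℝ (G u) (y - u))
        + ‖u - (u + γ • G u)‖ ^ 2) = 1 / (2 * γ) * ‖y - u‖ ^ 2 - inner ℝ (G u) (y - u)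
        + 1 / (2 * γ) * ‖u - (u + γ • G u)‖ ^ 2 := by field_simp
    rw [h3]
    have h4 : σ / 2 * ‖y - u‖ ^ 2 + 1 / (2 * γ) * ‖y - u‖ ^ 2
        = (1 + γ * σ) / (2 * γ) * ‖y - u‖ ^ 2 := by field_simp; ring
    have h5 : 0 ≤ (1 + γ * σ) / (2 * γ) * ‖y - u‖ ^ 2 := by positivity
    linarith

theorem proxMap_coe_eq_singleton {φ : E → ℝ} {G : E → E} {σ γ : ℝ}
    (hG : ∀ x, HasGradientAt φ (G x) x)
    (hσ : ∀ x y, σ * ‖x - y‖ ^ 2 ≤ inner ℝ (G x - G y) (x - y)) (hγ : 0 < γ)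
    (hγσ : 0 < 1 + γ * σ) {s u : E} (hs : s = u + γ • G u) :
    proxMap γ (fun x => (φ x : EReal)) s = {u} := by
  ext u'
  rw [mem_proxMap_coe_iff hG hσ hγ hγσ, Set.mem_singleton_iff]
  refine ⟨fun h => ?_, fun h => h ▸ hs⟩
  have h1 := mul_norm_sub_le_of_hypoconvex hσ hγ u' u
  rw [← hs, ← h, sub_self, norm_zero] at h1
  exact sub_eq_zero.1 (norm_le_zero_iff.1 (nonpos_of_mul_nonpos_right h1 hγσ))

theorem drEnvelope_eq {φ : E → ℝ} {F : E → EReal} {σ γ : ℝ}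
    (hG : ∀ x, HasGradientAt φ (gradient φ x) x)
    (hσ : ∀ x y, σ * ‖x - y‖ ^ 2 ≤ inner ℝ (gradient φ x - gradient φ y) (x - y)) (hγ : 0 < γ)
    (hγσ : 0 < 1 + γ * σ) (hF : ∀ w, F w ≠ ⊥) {s u v : E} {b : ℝ} (hs : s = u + γ • gradient φ u)
    (hv : v ∈ proxMap γ F ((2 : ℝ) • u - s)) (hb : F v = b) :
    drEnvelope γ (fun x => (φ x : EReal)) F s = (envelopeModel γ φ (gradient φ) u v b : EReal) := by
  rw [drEnvelope, proxMap_coe_eq_singleton hG hσ hγ hγσ hs, iInf_singleton]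
  have hval : ∀ w (r : ℝ), F w = r → (φ u : EReal) + F w +
      ((inner ℝ (egradient (fun x => (φ x : EReal)) u) (w - u) +
        1 / (2 * γ) * ‖w - u‖ ^ 2 : ℝ) : EReal) =
      (envelopeModel γ φ (gradient φ) u w r : EReal) := by
    intro w r hr
    rw [hr, envelopeModel]
    norm_cast
    simp only [egradient, EReal.toReal_coe]
    ring
  refine le_antisymm ((iInf_le _ v).trans (hval v b hb).le) (le_iInf fun w => ?_)
  rcases eq_or_ne (F w) ⊤ with h | h
  · rw [h, EReal.coe_add_top, EReal.top_add_coe]; exact le_top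
  · have hr := (EReal.coe_toReal h (hF w)).symm
    rw [hval w _ hr, EReal.coe_le_coe_iff, envelopeModel_eq hγ, envelopeModel_eq hγ, ← hs]
    have := le_of_mem_proxMap hv hb hr
    linarith

/-- With `b = F v` at a proximal point `v`, the envelope dominates `φ + F` at `v`. This is what turns
a bound on the envelope into membership of a sublevel set of `φ + F`. -/
theorem add_le_envelopeModel {φ : E → ℝ} {G : E → E} {L γ : ℝ}
    (hG : ∀ x, HasGradientAt φ (G x) x)
    (hL : ∀ x y, inner ℝ (G x - G y) (x - y) ≤ L * ‖x - y‖ ^ 2) (hγ : 0 < γ) (hγL : γ * L < 1)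
    (u v : E) (b : ℝ) : φ v + b ≤ envelopeModel γ φ G u v b := by
  have h1 := le_add_inner_add_sq_of_gradient hG hL u v
  have h2 : L / 2 ≤ 1 / (2 * γ) := by
    rw [div_le_div_iff₀ (by norm_num) (by positivity)]; linarith
  have h3 := mul_le_mul_of_nonneg_right h2 (sq_nonneg ‖v - u‖)
  rw [envelopeModel]
  linarith

/-- A Douglas-Rachford step from `s = u + γ∇φ(u)` to `s⁺ = s + v - u = u⁺ + γ∇φ(u⁺)` decreases the
envelope by a multiple of `‖v - u‖²`. -/
theorem exists_mul_norm_sq_le_envelopeModel_sub {φ : E → ℝ} {G : E → E} {L σ γ : ℝ}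
    (hG : ∀ x, HasGradientAt φ (G x) x) (hL0 : 0 ≤ L)
    (hL : ∀ x y, ‖G x - G y‖ ≤ L * ‖x - y‖)
    (hσ : ∀ x y, σ * ‖x - y‖ ^ 2 ≤ inner ℝ (G x - G y) (x - y))
    (hγ : 0 < γ) (hγσ : γ * (2 * max (-σ) 0) < 1) (hγL : γ * L < 1) :
    ∃ c : ℝ, 0 < c ∧ ∀ (u u' v : E) (b : ℝ), u' + γ • G u' = v + γ • G u →
      c * ‖v - u‖ ^ 2 ≤ envelopeModel γ φ G u v b - envelopeModel γ φ G u' v b := by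
  -- enlarging `L` within `γ L < 1` and replacing `σ` by `min σ 0` gives `σ' ≤ 0 < L'`, so that the
  -- interpolation inequality may divide by `L' - σ'`
  obtain ⟨L', hLL', hL'γ⟩ : ∃ L', L < L' ∧ γ * L' < 1 := by
    refine ⟨(L + 1 / γ) / 2, ?_, ?_⟩
    · have : L < 1 / γ := by rw [lt_div_iff₀ hγ]; linarith
      linarith
    · have : γ * ((L + 1 / γ) / 2) = (γ * L + 1) / 2 := by field_simp
      linarith
  obtain ⟨σ', hσ'0, hσ'σ, hσ'γ⟩ : ∃ σ', σ' ≤ 0 ∧ σ' ≤ σ ∧ γ * (2 * -σ') < 1 := by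
    refine ⟨-max (-σ) 0, by simp, ?_, by simpa using hγσ⟩
    have := le_max_left (-σ) 0
    linarith
  have hL'0 : 0 < L' := by linarith
  have hLip : ∀ x y, ‖G x - G y‖ ≤ L' * ‖x - y‖ := fun x y =>
    (hL x y).trans (mul_le_mul_of_nonneg_right hLL'.le (norm_nonneg _))
  have hinner : ∀ x y, inner ℝ (G x - G y) (x - y) ≤ L' * ‖x - y‖ ^ 2 := fun x y => by
    have h1 := real_inner_le_norm (G x - G y) (x - y)
    have h2 := mul_le_mul_of_nonneg_right (hLip x y) (norm_nonneg (x - y))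
    nlinarith
  have hσ' : ∀ x y, σ' * ‖x - y‖ ^ 2 ≤ inner ℝ (G x - G y) (x - y) := fun x y =>
    (mul_le_mul_of_nonneg_right hσ'σ (sq_nonneg _)).trans (hσ x y)
  have hℓ : σ' < L' := by linarith
  obtain ⟨c, hc, hdec⟩ := exists_decrease_const hL'0 hσ'0 hγ hσ'γ hL'γ
  refine ⟨c / 4, by positivity, fun u u' v b huv => ?_⟩
  set d := u - u' with hd
  set e := G u - G u' with he
  have hvu : v - u = -(d + γ • e) := by
    have : v = u' + γ • G u' - γ • G u := by rw [huv]; abel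
    rw [this, hd, he, smul_sub]; abel
  have hvu' : v - u' = -(γ • e) := by
    have : v = u' + γ • G u' - γ • G u := by rw [huv]; abel
    rw [this, he, smul_sub]; abel
  have hGu : G u = G u' + e := by rw [he]; abel
  have hexp : ‖e - σ' • d‖ ^ 2 = ‖e‖ ^ 2 - 2 * σ' * inner ℝ e d + σ' ^ 2 * ‖d‖ ^ 2 := by
    rw [norm_sub_sq_real, inner_smul_right, norm_smul, mul_pow, Real.norm_eq_abs, sq_abs]; ring
  have hN : ‖e‖ ^ 2 ≤ L' ^ 2 * ‖d‖ ^ 2 := by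
    rw [← mul_pow]; exact pow_le_pow_left₀ (norm_nonneg _) (hLip u u') 2
  have hB1 := bregman_ge hℓ hG hσ' hinner u u'
  have hB2 := bregman_ge hℓ hG hσ' hinner u' u
  rw [← hd, ← he, hexp] at hB1
  rw [← neg_sub u u', ← neg_sub (G u) (G u'), ← hd, ← he, smul_neg, neg_sub_neg,
    norm_sub_rev, norm_neg, hexp, inner_neg_right, hGu, inner_add_left] at hB2
  have hB0 := add_inner_add_sq_le_of_gradient hG hσ' u' u
  rw [← hd] at hB0
  have hco : ‖e‖ ^ 2 - 2 * σ' * inner ℝ e d + σ' ^ 2 * ‖d‖ ^ 2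
      ≤ (L' - σ') * (inner ℝ e d - σ' * ‖d‖ ^ 2) := by
    have h1 : 0 < L' - σ' := by linarith
    have h2 : 2 * (1 / (2 * (L' - σ')) *
        (‖e‖ ^ 2 - 2 * σ' * inner ℝ e d + σ' ^ 2 * ‖d‖ ^ 2)) ≤
        inner ℝ e d - σ' * ‖d‖ ^ 2 := by linarith
    have h3 := mul_le_mul_of_nonneg_left h2 h1.le
    rwa [show (L' - σ') * (2 * (1 / (2 * (L' - σ')) *
        (‖e‖ ^ 2 - 2 * σ' * inner ℝ e d + σ' ^ 2 * ‖d‖ ^ 2))) =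
        ‖e‖ ^ 2 - 2 * σ' * inner ℝ e d + σ' ^ 2 * ‖d‖ ^ 2 by field_simp] at h3
  have hmain := hdec (‖d‖ ^ 2) (inner ℝ e d) (‖e‖ ^ 2) (φ u - φ u' - inner ℝ (G u') d)
    (sq_nonneg _) (hσ' u u') (hinner u u') hN hco (by linarith) hB1
  have hnorm : ‖v - u‖ ≤ 2 * ‖d‖ := by
    rw [hvu, norm_neg]
    refine (norm_add_le _ _).trans ?_
    rw [norm_smul, Real.norm_of_nonneg hγ.le]
    have h1 := mul_le_mul_of_nonneg_left (hLip u u') hγ.le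
    have h2 := mul_le_mul_of_nonneg_right hL'γ.le (norm_nonneg d)
    rw [← hd, ← he] at h1
    linarith
  have hsq : ‖v - u‖ ^ 2 ≤ 4 * ‖d‖ ^ 2 := by
    have := pow_le_pow_left₀ (norm_nonneg _) hnorm 2
    linarith
  have hid : envelopeModel γ φ G u v b - envelopeModel γ φ G u' v b =
      φ u - φ u' - inner ℝ (G u') d + 1 / (2 * γ) * ‖d‖ ^ 2 - γ * ‖e‖ ^ 2 := by
    rw [envelopeModel, envelopeModel, hvu, hvu', hGu]
    simp only [norm_neg, inner_neg_right, inner_add_right, inner_add_left, inner_smul_right,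
      norm_add_sq_real, norm_smul, mul_pow, Real.norm_eq_abs, sq_abs, real_inner_self_eq_norm_sq,
      real_inner_comm e d]
    field_simp
    ring
  rw [hid]
  have := mul_le_mul_of_nonneg_left hsq hc.le
  linarith

end Prox

/-! ### Subgradients and the Kurdyka-Łojasiewicz inequality -/

section KL

variable {E : Type*} [NormedAddCommGroup E]

theorem norm_sq_toLp_three (x : PiLp 2 (fun _ : Fin 3 => E)) :
    ‖x‖ ^ 2 = ‖x 0‖ ^ 2 + ‖x 1‖ ^ 2 + ‖x 2‖ ^ 2 := by
  rw [PiLp.norm_sq_eq_of_L2, Fin.sum_univ_three]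

/-- Proximal points pass to the limit, together with their values. -/
theorem mem_proxMap_of_tendsto {γ : ℝ} {F : E → EReal} (hlsc : LowerSemicontinuous F)
    (hF : ∀ w, F w ≠ ⊥) {y v : ℕ → E} {b : ℕ → ℝ} {yb vb : E} {β : ℝ}
    (hv : ∀ n, v n ∈ proxMap γ F (y n)) (hb : ∀ n, F (v n) = b n)
    (hy : Tendsto y atTop (𝓝 yb)) (hvt : Tendsto v atTop (𝓝 vb)) (hbt : Tendsto b atTop (𝓝 β)) :
    F vb = β ∧ vb ∈ proxMap γ F yb := by
  have hle : F vb ≤ β := by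
    by_contra hcon
    push Not at hcon
    obtain ⟨z, hz1, hz2⟩ := EReal.lt_iff_exists_real_btwn.1 hcon
    have h1 := hvt.eventually (hlsc vb z hz2)
    have h2 : ∀ᶠ n in atTop, z ≤ b n := h1.mono fun n hn => by
      have hn' : (z : EReal) < F (v n) := hn
      rw [hb n] at hn'; exact_mod_cast hn'.le
    have h3 := ge_of_tendsto hbt h2
    exact absurd hz1 (not_lt.2 (by exact_mod_cast h3))
  have hlim : ∀ w (r : ℝ), F w = r →
      β + 1 / (2 * γ) * ‖vb - yb‖ ^ 2 ≤ r + 1 / (2 * γ) * ‖w - yb‖ ^ 2 := by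
    intro w r hr
    refine le_of_tendsto_of_tendsto' (hbt.add (((hvt.sub hy).norm.pow 2).const_mul _))
      (((((tendsto_const_nhds (x := w)).sub hy).norm.pow 2).const_mul (1 / (2 * γ))).const_add r)
      fun n => le_of_mem_proxMap (hv n) (hb n) hr
  have hfin := (EReal.coe_toReal (ne_top_of_le_ne_top (EReal.coe_ne_top _) hle) (hF vb)).symm
  have heq : F vb = β := by
    refine le_antisymm hle ?_
    have := hlim vb _ hfin
    rw [hfin, EReal.coe_le_coe_iff]
    linarith
  refine ⟨heq, fun w => ?_⟩
  rcases eq_or_ne (F w) ⊤ with h | h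
  · simp only [h, EReal.top_add_coe]; exact le_top
  · have hr := (EReal.coe_toReal h (hF w)).symm
    have := hlim w _ hr
    simp only [heq]
    rw [hr]
    exact_mod_cast this

/-- A one-sided comparison that holds near every cluster point of a sequence in a compact set
holds eventually, with a uniform constant. -/
theorem exists_eventually_le_of_mapClusterPt {X : Type*} [TopologicalSpace X] {K : Set X}
    (hK : IsCompact K) {t : ℕ → X} (ht : ∀ k, t k ∈ K) {a b : ℕ → ℝ} (hb : ∀ k, 0 ≤ b k)
    (h : ∀ x, MapClusterPt x atTop t → ∃ U ∈ 𝓝 x, ∃ C : ℝ, ∀ᶠ k in atTop, t k ∈ U → a k ≤ C * b k) :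
    ∃ C : ℝ, ∀ᶠ k in atTop, a k ≤ C * b k := by
  have key : ∃ C : ℝ, ∀ᶠ k in atTop, t k ∈ K → a k ≤ C * b k := by
    refine hK.induction_on (p := fun S => ∃ C : ℝ, ∀ᶠ k in atTop, t k ∈ S → a k ≤ C * b k)
      ⟨0, by simp⟩ ?_ ?_ ?_
    · rintro S T hST ⟨C, hC⟩
      exact ⟨C, hC.mono fun k hk hkS => hk (hST hkS)⟩
    · rintro S T ⟨C, hC⟩ ⟨C', hC'⟩
      refine ⟨max C C', ?_⟩
      filter_upwards [hC, hC'] with k hk hk' hkST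
      rcases hkST with hkS | hkT
      · exact (hk hkS).trans (mul_le_mul_of_nonneg_right (le_max_left _ _) (hb k))
      · exact (hk' hkT).trans (mul_le_mul_of_nonneg_right (le_max_right _ _) (hb k))
    · intro x _
      by_cases hx : MapClusterPt x atTop t
      · obtain ⟨U, hU, hC⟩ := h x hx
        exact ⟨U, mem_nhdsWithin_of_mem_nhds hU, hC⟩
      · rw [mapClusterPt_iff_frequently] at hx
        push Not at hx
        obtain ⟨U, hU, hfreq⟩ := hx
        exact ⟨U, mem_nhdsWithin_of_mem_nhds hU, 0, hfreq.mono fun k hk hkU => absurd hkU hk⟩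
  obtain ⟨C, hC⟩ := key
  exact ⟨C, hC.mono fun k hk => hk (ht k)⟩

variable [InnerProductSpace ℝ E]

theorem regularSubdiff_subset_limitingSubdiff (F : E → EReal) (x : E) :
    regularSubdiff F x ⊆ limitingSubdiff F x := fun ξ h =>
  ⟨h.1, h.2.1, fun _ => x, fun _ => ξ, fun _ => h, tendsto_const_nhds, tendsto_const_nhds,
    tendsto_const_nhds⟩

/-- With exponent at most `1/2`, the Kurdyka-Łojasiewicz inequality bounds the excess of the
function value by a multiple of the squared norm of any subgradient. -/
theorem HasKLExponentAt.exists_sub_le_mul_sq {ψ : E → EReal} {x₀ : E} {θ : ℝ}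
    (h : HasKLExponentAt ψ x₀ θ) (hθ : θ ∈ Set.Ioc (0 : ℝ) (1 / 2)) {d₀ : ℝ} (hd₀ : ψ x₀ = d₀) :
    ∃ U ∈ 𝓝 x₀, ∃ η : ℝ, 0 < η ∧ ∃ C : ℝ, ∀ x ∈ U, ∀ (d : ℝ) (ξ : E), ψ x = d →
      ξ ∈ limitingSubdiff ψ x → 0 < d - d₀ → d - d₀ < η → d - d₀ ≤ C * ‖ξ‖ ^ 2 := by
  obtain ⟨-, η, hη, U, hU, q, hq, hKL⟩ := h
  obtain ⟨η', h0η', hη'⟩ := EReal.lt_iff_exists_real_btwn.1 hη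
  have hη'0 : 0 < η' := by exact_mod_cast h0η'
  refine ⟨U, hU, min η' 1, lt_min hη'0 one_pos, q ^ 2, fun x hx d ξ hd hξ h0 h1 => ?_⟩
  set τ := d - d₀ with hτ
  have hsub : ψ x - ψ x₀ = (τ : EReal) := by rw [hd, hd₀, hτ, EReal.coe_sub]
  have h2 := hKL x hx (by rw [hsub]; exact_mod_cast h0) (by
    rw [hsub]
    exact lt_trans (by exact_mod_cast h1.trans_le (min_le_left _ _)) hη')
  rw [hsub, EReal.toReal_coe] at h2
  have hder : deriv (fun t : ℝ => q * t ^ (1 - θ)) τ = q * ((1 - θ) * τ ^ (-θ)) := by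
    have := ((Real.hasDerivAt_rpow_const (p := 1 - θ) (Or.inl h0.ne')).const_mul q).deriv
    rw [this]
    congr 3
    ring
  rw [hder] at h2
  have h3 : Metric.infEDist 0 (limitingSubdiff ψ x) ≤ ENNReal.ofReal ‖ξ‖ := by
    refine (Metric.infEDist_le_edist_of_mem hξ).trans ?_
    rw [edist_dist, dist_zero_left]
  have hθ1 : 0 ≤ 1 - θ := by linarith [hθ.2]
  have hpow : 0 < τ ^ (-θ) := Real.rpow_pos_of_pos h0 _
  have h4 : (1 : ℝ) ≤ q * ((1 - θ) * τ ^ (-θ)) * ‖ξ‖ := by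
    rw [← ENNReal.one_le_ofReal, ENNReal.ofReal_mul (by positivity)]
    exact h2.trans (mul_le_mul_right h3 _)
  have h5 : τ ^ θ * τ ^ (-θ) = 1 := by rw [← Real.rpow_add h0]; simp
  have hpow' : 0 < τ ^ θ := Real.rpow_pos_of_pos h0 _
  have h6 : τ ^ θ ≤ q * ‖ξ‖ := by
    have h7 := mul_le_mul_of_nonneg_left h4 hpow'.le
    have h8 : τ ^ θ * (q * ((1 - θ) * τ ^ (-θ)) * ‖ξ‖) = (1 - θ) * (q * ‖ξ‖) := by
      linear_combination q * (1 - θ) * ‖ξ‖ * h5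
    rw [h8, mul_one] at h7
    have h9 : 0 ≤ q * ‖ξ‖ := by positivity
    nlinarith [hθ.1]
  have h10 : τ ^ (1 / 2 : ℝ) ≤ τ ^ θ :=
    Real.rpow_le_rpow_of_exponent_ge h0 (h1.le.trans (min_le_right _ _)) hθ.2
  rw [← Real.sqrt_eq_rpow] at h10
  calc τ = √τ ^ 2 := (Real.sq_sqrt h0.le).symm
    _ ≤ (q * ‖ξ‖) ^ 2 := pow_le_pow_left₀ (Real.sqrt_nonneg _) (h10.trans h6) 2
    _ = q ^ 2 * ‖ξ‖ ^ 2 := by ring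

theorem inner_toLp_three (x y : PiLp 2 (fun _ : Fin 3 => E)) :
    inner ℝ x y = inner ℝ (x 0) (y 0) + inner ℝ (x 1) (y 1) + inner ℝ (x 2) (y 2) := by
  rw [PiLp.inner_apply, Fin.sum_univ_three]

/-- An explicit subgradient of `𝔇` at a Douglas-Rachford triple. Its last component vanishes,
because stationarity of `𝔇` in the last variable is the optimality condition of the second
proximal step; the others are multiples of the residual `v - u`. -/
theorem mem_regularSubdiff_drLyapunov [CompleteSpace E] {φ : E → ℝ} {G : E → E} {F : E → EReal}
    {σ γ : ℝ} (hG : ∀ x, HasGradientAt φ (G x) x)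
    (hσ : ∀ x y, σ * ‖x - y‖ ^ 2 ≤ inner ℝ (G x - G y) (x - y)) (hγ : 0 < γ)
    (hF : ∀ w, F w ≠ ⊥) {s u v : E} {β : ℝ} (hs : s = u + γ • G u)
    (hv : v ∈ proxMap γ F ((2 : ℝ) • u - s)) (hβ : F v = β) :
    WithLp.toLp 2 ![(1 / γ) • (v - u), (-(2 / γ)) • (v - u), 0] ∈
      regularSubdiff (drLyapunov γ (fun x => (φ x : EReal)) F) (WithLp.toLp 2 ![s, u, v]) := by
  set ξ : PiLp 2 (fun _ : Fin 3 => E) :=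
    WithLp.toLp 2 ![(1 / γ) • (v - u), (-(2 / γ)) • (v - u), 0] with hξ
  set t₀ : PiLp 2 (fun _ : Fin 3 => E) := WithLp.toLp 2 ![s, u, v] with ht₀
  have hval := drLyapunov_eq hγ (φ := φ) hs hβ
  rw [← ht₀] at hval
  refine ⟨by rw [hval]; exact EReal.coe_ne_bot _, by rw [hval]; exact EReal.coe_ne_top _, ?_⟩
  set M := |σ| / 2 + 2 / γ with hM
  have hquad : ∀ t, drLyapunov γ (fun x => (φ x : EReal)) F t₀ +
      ((inner ℝ ξ (t - t₀) - M * ‖t - t₀‖ ^ 2 : ℝ) : EReal) ≤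
        drLyapunov γ (fun x => (φ x : EReal)) F t := by
    intro t
    rw [hval]
    rcases eq_or_ne (F (t 2)) ⊤ with h | h
    · rw [drLyapunov, h, EReal.coe_add_top, EReal.top_add_coe]; exact le_top
    have hr := (EReal.coe_toReal h (hF _)).symm
    set r := (F (t 2)).toReal with hr'
    rw [drLyapunov, hr]
    norm_cast
    have h1 := le_of_mem_proxMap hv hβ hr
    have h2 := add_inner_add_sq_le_of_gradient hG hσ u (t 1)
    obtain ⟨a, ha⟩ : ∃ a, a = t 0 - s := ⟨_, rfl⟩
    obtain ⟨b, hb⟩ : ∃ b, b = t 1 - u := ⟨_, rfl⟩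
    obtain ⟨c, hc⟩ : ∃ c, c = t 2 - v := ⟨_, rfl⟩
    obtain ⟨ρ, hρ⟩ : ∃ ρ, ρ = v - u := ⟨_, rfl⟩
    rw [inner_toLp_three, norm_sq_toLp_three]
    simp only [hξ, ht₀, PiLp.sub_apply, Matrix.cons_val, ← ha, ← hb, ← hc, ← hρ, inner_zero_left,
      inner_smul_left, conj_trivial]
    rw [← hb] at h2
    rw [show v - ((2 : ℝ) • u - s) = ρ + γ • G u by rw [hρ, hs, two_smul]; abel,
      show t 2 - ((2 : ℝ) • u - s) = (ρ + γ • G u) + c by rw [hρ, hc, hs, two_smul]; abel,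
      norm_add_sq_real (ρ + γ • G u) c, inner_add_left, inner_smul_left] at h1
    rw [show t 0 - t 1 = γ • G u + (a - b) by rw [ha, hb, hs]; abel,
      show t 2 - t 1 = ρ + (c - b) by rw [hρ, hc, hb]; abel, norm_add_sq_real ρ,
      norm_sub_sq_real c, envelopeModel, ← hρ]
    simp only [conj_trivial, inner_add_left, inner_add_right, inner_sub_left, inner_sub_right,
      inner_smul_left, real_inner_self_eq_norm_sq] at h1 ⊢
    -- what remains after the first-order terms cancel is a quadratic form in `a`, `b`, `c`
    have h3 : 0 ≤ ‖a + c‖ ^ 2 := sq_nonneg _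
    have h4 : 0 ≤ ‖a - b‖ ^ 2 := sq_nonneg _
    have h5 : 0 ≤ ‖b - c‖ ^ 2 := sq_nonneg _
    rw [norm_add_sq_real] at h3
    rw [norm_sub_sq_real] at h4 h5
    have h6 : -(|σ| / 2 * (‖a‖ ^ 2 + ‖b‖ ^ 2 + ‖c‖ ^ 2)) ≤ σ / 2 * ‖b‖ ^ 2 := by
      have h7 : -|σ| ≤ σ := neg_abs_le σ
      have h8 := mul_le_mul_of_nonneg_right h7 (sq_nonneg ‖b‖)
      have h9 := mul_nonneg (abs_nonneg σ) (add_nonneg (sq_nonneg ‖a‖) (sq_nonneg ‖c‖))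
      linarith
    have h10 : -(2 / γ * (‖a‖ ^ 2 + ‖b‖ ^ 2 + ‖c‖ ^ 2)) ≤
        1 / γ * (inner ℝ a c - inner ℝ a b - 2 * inner ℝ b c + 3 / 2 * ‖b‖ ^ 2) := by
      rw [show -(2 / γ * (‖a‖ ^ 2 + ‖b‖ ^ 2 + ‖c‖ ^ 2)) =
        1 / γ * (-(2 * (‖a‖ ^ 2 + ‖b‖ ^ 2 + ‖c‖ ^ 2))) by ring]
      refine mul_le_mul_of_nonneg_left ?_ (by positivity)
      linarith [sq_nonneg ‖a‖, sq_nonneg ‖b‖, sq_nonneg ‖c‖]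
    rw [hM, real_inner_comm ρ a, real_inner_comm ρ b, real_inner_comm b c]
    rw [show 1 / (2 * γ) = 1 / γ / 2 by field_simp] at h1 ⊢
    rw [show 2 / γ = 2 * (1 / γ) by ring] at h10 ⊢
    have hi : 1 / γ * γ = 1 := by field_simp
    generalize 1 / γ = i at *
    have e1 : i * γ * inner ℝ (G u) ρ = inner ℝ (G u) ρ := by rw [hi, one_mul]
    have e2 : i * γ * inner ℝ (G u) c = inner ℝ (G u) c := by rw [hi, one_mul]
    have e3 : i * γ * inner ℝ (G u) b = inner ℝ (G u) b := by rw [hi, one_mul]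
    linarith
  intro ε hε
  have hlim : Tendsto (fun t => M * ‖t - t₀‖) (𝓝 t₀) (𝓝 0) := by
    have : Continuous fun t => M * ‖t - t₀‖ := by fun_prop
    simpa using this.tendsto t₀
  filter_upwards [hlim.eventually_lt_const hε] with t ht
  refine le_trans (add_le_add_right ?_ _) (hquad t)
  rw [EReal.coe_le_coe_iff]
  have := mul_le_mul_of_nonneg_right ht.le (norm_nonneg (t - t₀))
  linarith

end KL

/-! ### R-linear and geometric rates -/

section Rates

variable {F : Type*} [NormedAddCommGroup F]

theorem RLinearlyConvergesTo.tendsto {a : ℕ → F} {l : F} (h : RLinearlyConvergesTo a l) :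
    Tendsto a atTop (𝓝 l) := by
  obtain ⟨C, r, hr0, hr1, h⟩ := h
  rw [tendsto_iff_norm_sub_tendsto_zero]
  refine squeeze_zero (fun _ => norm_nonneg _) h ?_
  simpa using (tendsto_pow_atTop_nhds_zero_of_lt_one hr0.le hr1).const_mul C

theorem RLinearlyConvergesTo.add {a b : ℕ → F} {l l' : F} (ha : RLinearlyConvergesTo a l)
    (hb : RLinearlyConvergesTo b l') : RLinearlyConvergesTo (fun k => a k + b k) (l + l') := by
  obtain ⟨C, r, hr0, hr1, ha⟩ := ha
  obtain ⟨C', r', hr0', hr1', hb⟩ := hb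
  have hC : 0 ≤ C := by simpa using (norm_nonneg _).trans (ha 0)
  have hC' : 0 ≤ C' := by simpa using (norm_nonneg _).trans (hb 0)
  refine ⟨C + C', max r r', lt_max_of_lt_left hr0, max_lt hr1 hr1', fun k => ?_⟩
  have h1 := mul_le_mul_of_nonneg_left (pow_le_pow_left₀ hr0.le (le_max_left r r') k) hC
  have h2 := mul_le_mul_of_nonneg_left (pow_le_pow_left₀ hr0'.le (le_max_right r r') k) hC'
  rw [add_sub_add_comm]
  linarith [norm_add_le (a k - l) (b k - l'), ha k, hb k]

theorem exists_rLinearlyConvergesTo_of_steps [CompleteSpace F] {a : ℕ → F} {C r : ℝ}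
    (hr0 : 0 < r) (hr1 : r < 1) (h : ∀ k, ‖a (k + 1) - a k‖ ≤ C * r ^ k) :
    ∃ l, RLinearlyConvergesTo a l := by
  have h' : ∀ k, dist (a k) (a (k + 1)) ≤ C * r ^ k := fun k => by
    rw [dist_comm, dist_eq_norm]; exact h k
  obtain ⟨l, hl⟩ := cauchySeq_tendsto_of_complete (cauchySeq_of_le_geometric r C hr1 h')
  refine ⟨l, C / (1 - r), r, hr0, hr1, fun k => ?_⟩
  rw [← dist_eq_norm]
  refine (dist_le_of_le_geometric_of_tendsto r C hr1 h' hl k).trans (le_of_eq ?_)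
  ring

/-- An antitone nonnegative sequence whose terms are eventually dominated by its own decrements
decays geometrically. -/
theorem exists_le_geometric_of_le_decrement {Δ : ℕ → ℝ} (h0 : ∀ k, 0 ≤ Δ k) (hanti : Antitone Δ)
    {C : ℝ} (h : ∀ᶠ k in atTop, Δ k ≤ C * (Δ k - Δ (k + 1))) :
    ∃ A r : ℝ, 0 ≤ A ∧ 0 < r ∧ r < 1 ∧ ∀ k, Δ k ≤ A * r ^ k := by
  obtain ⟨K, hK⟩ := eventually_atTop.1 h
  set M := max C 2 with hM
  have hM2 : 2 ≤ M := le_max_right _ _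
  have hM0 : 0 < M := by linarith
  set r := 1 - 1 / M with hr
  have hMr : M * r = M - 1 := by rw [hr]; field_simp
  have hr0 : 0 < r := by
    rw [hr, sub_pos, div_lt_one hM0]; linarith
  have hr1 : r < 1 := by
    rw [hr]; linarith [one_div_pos.2 hM0]
  have hstep : ∀ k, K ≤ k → Δ (k + 1) ≤ r * Δ k := fun k hk => by
    have h1 : Δ k ≤ M * (Δ k - Δ (k + 1)) := (hK k hk).trans
      (mul_le_mul_of_nonneg_right (le_max_left _ _) (sub_nonneg.2 (hanti k.le_succ)))
    have h2 : M * Δ (k + 1) ≤ M * (r * Δ k) := by rw [← mul_assoc, hMr]; linarith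
    exact le_of_mul_le_mul_left h2 hM0
  have hall : ∀ k, Δ k * r ^ K ≤ Δ 0 * r ^ k := by
    intro k
    induction k with
    | zero =>
      exact mul_le_mul_of_nonneg_left (by simpa using pow_le_one₀ hr0.le hr1.le) (h0 0)
    | succ k ih =>
      rcases lt_or_ge k K with hk | hk
      · exact mul_le_mul (hanti (Nat.zero_le _)) (pow_le_pow_of_le_one hr0.le hr1.le hk)
          (by positivity) (h0 0)
      · calc Δ (k + 1) * r ^ K ≤ r * Δ k * r ^ K :=
              mul_le_mul_of_nonneg_right (hstep k hk) (by positivity)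
          _ = r * (Δ k * r ^ K) := by ring
          _ ≤ r * (Δ 0 * r ^ k) := mul_le_mul_of_nonneg_left ih hr0.le
          _ = Δ 0 * r ^ (k + 1) := by ring
  refine ⟨Δ 0 / r ^ K, r, div_nonneg (h0 0) (by positivity), hr0, hr1, fun k => ?_⟩
  rw [div_mul_eq_mul_div, le_div_iff₀ (by positivity)]
  exact hall k

end Rates

/-! ### Convergence from sufficient decrease -/

section Convergence

variable {E : Type*} [NormedAddCommGroup E] [InnerProductSpace ℝ E] [CompleteSpace E]

/-- Along Douglas-Rachford triples, if the residual vanishes and the envelope values converge, then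
every limit is a stationary triple, `𝔇` at the limit is the limit of the envelope values, and the
limit of the `v` part is a proximal point. -/
theorem drLyapunov_eq_of_tendsto {φ : E → ℝ} {G : E → E} {F : E → EReal} {γ Ψ : ℝ}
    (hG : ∀ x, HasGradientAt φ (G x) x) (hGc : Continuous G) (hγ : 0 < γ)
    (hlsc : LowerSemicontinuous F) (hF : ∀ w, F w ≠ ⊥) {s u v : ℕ → E} {b : ℕ → ℝ} {s' u' v' : E}
    (hs : ∀ k, s k = u k + γ • G (u k)) (hv : ∀ k, v k ∈ proxMap γ F ((2 : ℝ) • u k - s k))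
    (hb : ∀ k, F (v k) = b k)
    (hΨ : Tendsto (fun k => envelopeModel γ φ G (u k) (v k) (b k)) atTop (𝓝 Ψ))
    (hr : Tendsto (fun k => v k - u k) atTop (𝓝 0)) (hst : Tendsto s atTop (𝓝 s'))
    (hut : Tendsto u atTop (𝓝 u')) (hvt : Tendsto v atTop (𝓝 v')) :
    v' = u' ∧ s' = u' + γ • G u' ∧ v' ∈ proxMap γ F ((2 : ℝ) • u' - s') ∧
      drLyapunov γ (fun x => (φ x : EReal)) F (WithLp.toLp 2 ![s', u', v']) = (Ψ : EReal) := by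
  have hvu : v' = u' := sub_eq_zero.1 (tendsto_nhds_unique (hvt.sub hut) hr)
  have hφc : Continuous φ := continuous_iff_continuousAt.2 fun x => (hG x).continuousAt
  have hGt : Tendsto (fun k => G (u k)) atTop (𝓝 (G u')) := (hGc.tendsto u').comp hut
  have hs' : s' = u' + γ • G u' := by
    refine tendsto_nhds_unique hst ?_
    simp only [funext hs]
    exact hut.add (hGt.const_smul γ)
  have hinner : Tendsto (fun k => inner ℝ (G (u k)) (v k - u k)) atTop (𝓝 0) := by
    simpa using hGt.inner hr
  have hsq : Tendsto (fun k => 1 / (2 * γ) * ‖v k - u k‖ ^ 2) atTop (𝓝 0) := by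
    simpa using (hr.norm.pow 2).const_mul (1 / (2 * γ))
  have hbt : Tendsto b atTop (𝓝 (Ψ - φ u')) := by
    have h1 := ((hΨ.sub ((hφc.tendsto u').comp hut)).sub hinner).sub hsq
    simp only [sub_zero] at h1
    refine h1.congr fun k => ?_
    simp only [envelopeModel, Function.comp_apply]
    ring
  obtain ⟨hval, hmem⟩ := mem_proxMap_of_tendsto hlsc hF hv hb
    ((hut.const_smul (2 : ℝ)).sub hst) hvt hbt
  refine ⟨hvu, hs', hmem, ?_⟩
  rw [drLyapunov_eq hγ hs' hval, envelopeModel, hvu]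
  simp

/-- Convergence of any sequence of Douglas-Rachford triples along which the envelope decreases by
a multiple of the squared residual and the squared step. How the next iterate is chosen plays no
role. -/
theorem rLinearlyConvergesTo_of_decrease [FiniteDimensional ℝ E] {φ : E → ℝ} {G : E → E}
    {F : E → EReal} {L σ γ : ℝ}
    (hG : ∀ x, HasGradientAt φ (G x) x)
    (hL0 : 0 ≤ L) (hL : ∀ x y, ‖G x - G y‖ ≤ L * ‖x - y‖)
    (hσ : ∀ x y, σ * ‖x - y‖ ^ 2 ≤ inner ℝ (G x - G y) (x - y))
    (hγ : 0 < γ) (hγL : γ * L < 1) (hγσ : 0 < 1 + γ * σ)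
    (hlsc : LowerSemicontinuous F) (hF : ∀ w, F w ≠ ⊥)
    {l₀ : ℝ} (hbelow : ∀ w (r : ℝ), F w = r → l₀ ≤ φ w + r)
    (hlev : LevelBounded fun w => (φ w : EReal) + F w)
    {s u v : ℕ → E} {b : ℕ → ℝ} (hs : ∀ k, s k = u k + γ • G (u k))
    (hv : ∀ k, v k ∈ proxMap γ F ((2 : ℝ) • u k - s k)) (hb : ∀ k, F (v k) = b k)
    {c : ℝ} (hc : 0 < c)
    (hdec : ∀ k, c * (‖v k - u k‖ ^ 2 + ‖s (k + 1) - s k‖ ^ 2) ≤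
      envelopeModel γ φ G (u k) (v k) (b k) -
        envelopeModel γ φ G (u (k + 1)) (v (k + 1)) (b (k + 1)))
    {θ : ℝ} (hθ : θ ∈ Set.Ioc (0 : ℝ) (1 / 2))
    (hKL : ∀ t : PiLp 2 (fun _ : Fin 3 => E),
      MapClusterPt t atTop (fun k => WithLp.toLp 2 ![s k, u k, v k]) →
        HasKLExponentAt (drLyapunov γ (fun x => (φ x : EReal)) F) t θ) :
    RLinearlyConvergesTo (fun k => ‖v k - u k‖) 0 ∧
      ∃ s' u' : E, RLinearlyConvergesTo s s' ∧ RLinearlyConvergesTo u u' ∧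
        RLinearlyConvergesTo v u' ∧ s' = u' + γ • G u' ∧
          u' ∈ proxMap γ F ((2 : ℝ) • u' - s') := by
  have hGc : Continuous G := (LipschitzWith.of_dist_le_mul (K := ⟨L, hL0⟩) fun x y => by
    rw [dist_eq_norm, dist_eq_norm]; exact hL x y).continuous
  have hinner : ∀ x y, inner ℝ (G x - G y) (x - y) ≤ L * ‖x - y‖ ^ 2 := fun x y => by
    have h1 := real_inner_le_norm (G x - G y) (x - y)
    have h2 := mul_le_mul_of_nonneg_right (hL x y) (norm_nonneg (x - y))
    nlinarith
  set P : ℕ → ℝ := fun k => envelopeModel γ φ G (u k) (v k) (b k) with hP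
  -- the envelope values decrease to a limit, and the residuals vanish
  have hPanti : Antitone P := antitone_nat_of_succ_le fun k => by
    have h1 : 0 ≤ c * (‖v k - u k‖ ^ 2 + ‖s (k + 1) - s k‖ ^ 2) := by positivity
    linarith [hdec k]
  have hPv : ∀ k, φ (v k) + b k ≤ P k := fun k =>
    add_le_envelopeModel hG hinner hγ hγL (u k) (v k) (b k)
  have hPbdd : BddBelow (Set.range P) :=
    ⟨l₀, Set.forall_mem_range.2 fun k => (hbelow _ _ (hb k)).trans (hPv k)⟩
  set Ψ := ⨅ k, P k with hΨ
  have hPt : Tendsto P atTop (𝓝 Ψ) := tendsto_atTop_ciInf hPanti hPbdd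
  set Δ : ℕ → ℝ := fun k => P k - Ψ with hΔ
  have hΔ0 : ∀ k, 0 ≤ Δ k := fun k => sub_nonneg.2 (ciInf_le hPbdd k)
  have hΔt : Tendsto Δ atTop (𝓝 0) := by simpa using hPt.sub_const Ψ
  have hΔanti : Antitone Δ := fun i j hij => sub_le_sub_right (hPanti hij) Ψ
  have hrΔ : ∀ k, ‖v k - u k‖ ^ 2 ≤ 1 / c * (Δ k - Δ (k + 1)) := fun k => by
    have h1 := hdec k
    have h2 := mul_nonneg hc.le (sq_nonneg ‖s (k + 1) - s k‖)
    rw [one_div_mul_eq_div, le_div_iff₀ hc]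
    simp only [hΔ, hP]
    linarith
  have hrΔ' : ∀ k, ‖v k - u k‖ ^ 2 ≤ 1 / c * Δ k := fun k =>
    (hrΔ k).trans (mul_le_mul_of_nonneg_left (by linarith [hΔ0 (k + 1)]) (by positivity))
  have hsΔ : ∀ k, ‖s (k + 1) - s k‖ ^ 2 ≤ 1 / c * Δ k := fun k => by
    have h1 := hdec k
    have h2 := mul_nonneg hc.le (sq_nonneg ‖v k - u k‖)
    have h3 : P k - P (k + 1) ≤ Δ k := by
      have := hΔ0 (k + 1)
      simp only [hΔ] at this ⊢
      linarith
    rw [one_div_mul_eq_div, le_div_iff₀ hc]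
    simp only [hP] at h3
    linarith
  have hrt : Tendsto (fun k => v k - u k) atTop (𝓝 0) := by
    rw [tendsto_zero_iff_norm_tendsto_zero]
    have h1 : Tendsto (fun k => ‖v k - u k‖ ^ 2) atTop (𝓝 0) :=
      squeeze_zero (fun _ => sq_nonneg _) hrΔ' (by simpa using hΔt.const_mul (1 / c))
    simpa [Real.sqrt_sq (norm_nonneg _)] using h1.sqrt
  -- the triples stay in a compact set
  obtain ⟨R, hR⟩ : ∃ R, ∀ k, ‖v k‖ ≤ R := by
    obtain ⟨R, hR⟩ := (hlev (P 0)).exists_norm_le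
    refine ⟨R, fun k => hR _ ?_⟩
    simp only [Set.mem_ofPred_eq, hb k]
    exact_mod_cast (hPv k).trans (hPanti (Nat.zero_le k))
  obtain ⟨R', hR'⟩ := (Metric.isBounded_range_of_tendsto _ hrt).exists_norm_le
  have hRu : ∀ k, ‖u k‖ ≤ R + R' := fun k => by
    rw [show u k = v k - (v k - u k) by abel]
    exact (norm_sub_le _ _).trans (add_le_add (hR k) (hR' _ ⟨k, rfl⟩))
  set T : E × E → PiLp 2 (fun _ : Fin 3 => E) := fun p =>
    WithLp.toLp 2 ![p.1 + γ • G p.1, p.1, p.2] with hT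
  have hTc : Continuous T := by
    refine (PiLp.continuous_toLp 2 _).comp (continuous_pi fun i => ?_)
    fin_cases i
    · exact continuous_fst.add ((hGc.comp continuous_fst).const_smul γ)
    · exact continuous_fst
    · exact continuous_snd
  set t : ℕ → PiLp 2 (fun _ : Fin 3 => E) := fun k => WithLp.toLp 2 ![s k, u k, v k] with ht
  have : ProperSpace E := FiniteDimensional.proper ℝ E
  have hcomp : IsCompact (T '' (Metric.closedBall 0 (R + R') ×ˢ Metric.closedBall 0 R)) :=
    ((isCompact_closedBall _ _).prod (isCompact_closedBall _ _)).image hTc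
  have htmem : ∀ k, t k ∈ T '' (Metric.closedBall 0 (R + R') ×ˢ Metric.closedBall 0 R) := fun k =>
    ⟨(u k, v k), ⟨mem_closedBall_zero_iff.2 (hRu k), mem_closedBall_zero_iff.2 (hR k)⟩, by
      simp only [hT, ht, hs k]⟩
  -- the Kurdyka-Łojasiewicz inequality, made uniform over the cluster points
  obtain ⟨C, hC⟩ : ∃ C : ℝ, ∀ᶠ k in atTop, Δ k ≤ C * ‖v k - u k‖ ^ 2 := by
    refine exists_eventually_le_of_mapClusterPt hcomp htmem (fun k => sq_nonneg _) fun x hx => ?_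
    have hval : drLyapunov γ (fun x => (φ x : EReal)) F x = (Ψ : EReal) := by
      obtain ⟨n, hn, hnt⟩ := hx.tendsto_subseq
      have hcoord : ∀ i : Fin 3, Tendsto (fun k => t (n k) i) atTop (𝓝 (x i)) := fun i =>
        ((PiLp.continuous_apply 2 (fun _ : Fin 3 => E) i).tendsto x).comp hnt
      have h := (drLyapunov_eq_of_tendsto (φ := φ) (Ψ := Ψ) hG hGc hγ hlsc hF (fun k => hs (n k))
        (fun k => hv (n k)) (fun k => hb (n k)) (hPt.comp hn.tendsto_atTop)
        (hrt.comp hn.tendsto_atTop) (hcoord 0) (hcoord 1) (hcoord 2)).2.2.2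
      rwa [show WithLp.toLp 2 ![x 0, x 1, x 2] = x by ext i; fin_cases i <;> rfl] at h
    obtain ⟨U, hU, η, hη, C, hC⟩ := (hKL x hx).exists_sub_le_mul_sq hθ hval
    refine ⟨U, hU, max C 0 * (5 / γ ^ 2), ?_⟩
    filter_upwards [hΔt.eventually_lt_const hη] with k hk hkU
    rcases (hΔ0 k).eq_or_lt with h0 | h0
    · rw [← h0]; positivity
    have hξ := regularSubdiff_subset_limitingSubdiff _ _
      (mem_regularSubdiff_drLyapunov hG hσ hγ hF (hs k) (hv k) (hb k))
    have h1 := hC _ hkU _ _ (drLyapunov_eq hγ (hs k) (hb k)) hξ h0 hk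
    refine h1.trans ((mul_le_mul_of_nonneg_right (le_max_left C 0) (sq_nonneg _)).trans
      (le_of_eq ?_))
    rw [norm_sq_toLp_three]
    simp only [Matrix.cons_val, norm_smul, norm_zero, mul_pow, Real.norm_eq_abs, sq_abs]
    field_simp
    ring
  have hdecr : ∀ᶠ k in atTop, Δ k ≤ max C 0 * (1 / c) * (Δ k - Δ (k + 1)) := by
    filter_upwards [hC] with k hk
    rw [mul_assoc]
    exact hk.trans ((mul_le_mul_of_nonneg_right (le_max_left C 0) (sq_nonneg _)).trans
      (mul_le_mul_of_nonneg_left (hrΔ k) (le_max_right _ _)))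
  obtain ⟨A, r, hA, hr0, hr1, hgeo⟩ := exists_le_geometric_of_le_decrement hΔ0 hΔanti hdecr
  -- square roots of the geometric bounds
  have hroot : ∀ (y : ℝ) (k : ℕ), 0 ≤ y → y ^ 2 ≤ 1 / c * Δ k → y ≤ √(1 / c * A) * √r ^ k := by
    intro y k hy hyk
    refine le_of_sq_le_sq ?_ (by positivity)
    rw [mul_pow, Real.sq_sqrt (by positivity), ← pow_mul, mul_comm k, pow_mul, Real.sq_sqrt hr0.le,
      mul_assoc]
    exact hyk.trans (mul_le_mul_of_nonneg_left (hgeo k) (by positivity))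
  have hq0 : 0 < √r := Real.sqrt_pos.2 hr0
  have hq1 : √r < 1 := by rw [Real.sqrt_lt' one_pos]; simpa using hr1
  have hrlin : RLinearlyConvergesTo (fun k => v k - u k) 0 :=
    ⟨_, √r, hq0, hq1, fun k => by
      rw [sub_zero]; exact hroot _ k (norm_nonneg _) (hrΔ' k)⟩
  obtain ⟨s', hs'⟩ := exists_rLinearlyConvergesTo_of_steps hq0 hq1 fun k =>
    hroot _ k (norm_nonneg _) (hsΔ k)
  obtain ⟨u', hu'⟩ := exists_rLinearlyConvergesTo_of_steps (a := u)
    (C := √(1 / c * A) / (1 + γ * σ)) hq0 hq1 fun k => by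
      rw [div_mul_eq_mul_div, le_div_iff₀ hγσ, mul_comm]
      refine le_trans ?_ (hroot _ k (norm_nonneg _) (hsΔ k))
      rw [hs, hs]
      exact mul_norm_sub_le_of_hypoconvex hσ hγ _ _
  have hv' : RLinearlyConvergesTo v u' := by simpa using hu'.add hrlin
  obtain ⟨-, h1, h2, -⟩ := drLyapunov_eq_of_tendsto (φ := φ) hG hGc hγ hlsc hF hs hv hb hPt hrt
    hs'.tendsto hu'.tendsto hv'.tendsto
  refine ⟨?_, s', u', hs', hu', hv', h1, h2⟩
  obtain ⟨C, r, h0, h1, h⟩ := hrlin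
  exact ⟨C, r, h0, h1, fun k => by simpa using h k⟩

end Convergence

/-! ### Iterates of the accelerated method -/

section Run

variable {X Z E : Type*} [AddCommGroup X] [Module ℝ X] [AddCommGroup Z] [Module ℝ Z]
  [NormedAddCommGroup E] [InnerProductSpace ℝ E] [CompleteSpace E]
  {f : X → EReal} {g : Z → EReal} {A : X →ₗ[ℝ] E} {B : Z →ₗ[ℝ] E} {c : E}
  {γ ν₁ ν₂ : ℝ} {m : ℕ} {s u v sAA : ℕ → E} {x : ℕ → X} {z : ℕ → Z}

theorem IsAARun.u_mem_proxMap (h : IsAARun f g A B c γ ν₁ ν₂ m s u v sAA x z) (k : ℕ) :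
    u k ∈ proxMap γ (imageFun A f) (s k) := fun w => by
  rw [h.u_eq k]
  exact imageFun_add_le_of_mem_argminSet (q := fun y => 1 / (2 * γ) * ‖y - s k‖ ^ 2) (h.x_mem k) w

theorem IsAARun.v_mem_proxMap (h : IsAARun f g A B c γ ν₁ ν₂ m s u v sAA x z) (k : ℕ) :
    v k ∈ proxMap γ (fun w => imageFun B g (w - c)) ((2 : ℝ) • u k - s k) := fun w => by
  have := imageFun_add_le_of_mem_argminSet
    (q := fun y => 1 / (2 * γ) * ‖y + c - ((2 : ℝ) • u k - s k)‖ ^ 2) (h.z_mem k) (w - c)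
  simpa only [h.v_eq k, add_sub_cancel_right, sub_add_cancel] using this

/-- The envelope decreases at every step: by the acceptance test at an accelerated step, and by
the decrease of the Douglas-Rachford step otherwise. -/
theorem IsAARun.exists_decrease {φ : E → ℝ} {F : E → EReal} {L σ : ℝ} {b : ℕ → ℝ}
    (h : IsAARun f g A B c γ ν₁ ν₂ m s u v sAA x z)
    (hφ : imageFun A f = fun x => (φ x : EReal)) (hF : (fun w => imageFun B g (w - c)) = F)
    (hFbot : ∀ w, F w ≠ ⊥)
    (hG : ∀ x, HasGradientAt φ (gradient φ x) x) (hL0 : 0 ≤ L)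
    (hL : ∀ x y, ‖gradient φ x - gradient φ y‖ ≤ L * ‖x - y‖)
    (hσ : ∀ x y, σ * ‖x - y‖ ^ 2 ≤ inner ℝ (gradient φ x - gradient φ y) (x - y))
    (hγ : 0 < γ) (hγσ : γ * (2 * max (-σ) 0) < 1) (hγL : γ * L < 1) (hγσ' : 0 < 1 + γ * σ)
    (hν₁ : 0 < ν₁) (hν₂ : 0 < ν₂) (hb : ∀ k, F (v k) = b k) :
    ∃ κ : ℝ, 0 < κ ∧ ∀ k, κ * (‖v k - u k‖ ^ 2 + ‖s (k + 1) - s k‖ ^ 2) ≤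
      envelopeModel γ φ (gradient φ) (u k) (v k) (b k) -
        envelopeModel γ φ (gradient φ) (u (k + 1)) (v (k + 1)) (b (k + 1)) := by
  have hu : ∀ k, s k = u k + γ • gradient φ (u k) := fun k =>
    (mem_proxMap_coe_iff hG hσ hγ hγσ').1 (hφ ▸ h.u_mem_proxMap k)
  have hv : ∀ k, v k ∈ proxMap γ F ((2 : ℝ) • u k - s k) := fun k => hF ▸ h.v_mem_proxMap k
  have henv : ∀ k, drEnvelope γ (fun x => (φ x : EReal)) F (s k) =
      (envelopeModel γ φ (gradient φ) (u k) (v k) (b k) : EReal) := fun k =>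
    drEnvelope_eq hG hσ hγ hγσ' hFbot (hu k) (hv k) (hb k)
  obtain ⟨κ, hκ, hdr⟩ := exists_mul_norm_sq_le_envelopeModel_sub hG hL0 hL hσ hγ hγσ hγL
  have hκ₁ : min (min ν₁ ν₂) (κ / 2) ≤ ν₁ := (min_le_left _ _).trans (min_le_left _ _)
  have hκ₂ : min (min ν₁ ν₂) (κ / 2) ≤ ν₂ := (min_le_left _ _).trans (min_le_right _ _)
  have hκ₃ : min (min ν₁ ν₂) (κ / 2) ≤ κ / 2 := min_le_right _ _
  refine ⟨min (min ν₁ ν₂) (κ / 2), by positivity, fun k => ?_⟩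
  have hacc := h.accept k
  have hrej := h.reject k
  rw [hφ, hF] at hacc hrej
  by_cases hk : drEnvelope γ (fun x => (φ x : EReal)) F (sAA k)
        - drEnvelope γ (fun x => (φ x : EReal)) F (s k)
      ≤ ((-ν₁ * ‖(s k + v k - u k) - s k‖ ^ 2 - ν₂ * ‖sAA k - s k‖ ^ 2 : ℝ) : EReal)
  · rw [← hacc hk, henv, henv, ← EReal.coe_sub, EReal.coe_le_coe_iff,
      show s k + v k - u k - s k = v k - u k by abel] at hk
    have h1 := mul_le_mul_of_nonneg_right hκ₁ (sq_nonneg ‖v k - u k‖)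
    have h2 := mul_le_mul_of_nonneg_right hκ₂ (sq_nonneg ‖s (k + 1) - s k‖)
    linarith
  · have hnext := hrej hk
    have h1 := hdr (u k) (u (k + 1)) (v k) (b k) (by
      rw [← hu (k + 1), hnext, hu k]; abel)
    have h2 : envelopeModel γ φ (gradient φ) (u (k + 1)) (v (k + 1)) (b (k + 1)) ≤
        envelopeModel γ φ (gradient φ) (u (k + 1)) (v k) (b k) := by
      rw [envelopeModel_eq hγ, envelopeModel_eq hγ, ← hu]
      have := le_of_mem_proxMap (hv (k + 1)) (hb (k + 1)) (hb k)
      linarith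
    rw [hnext, show s k + v k - u k - s k = v k - u k by abel]
    have h3 := mul_le_mul_of_nonneg_right hκ₃ (sq_nonneg ‖v k - u k‖)
    linarith

end Run

end AADR

theorem mainTheorem3 (n₁ n₂ p : ℕ)
    (f : EuclideanSpace ℝ (Fin n₁) → EReal) (g : EuclideanSpace ℝ (Fin n₂) → EReal)
    (A : EuclideanSpace ℝ (Fin n₁) →ₗ[ℝ] EuclideanSpace ℝ (Fin p))
    (B : EuclideanSpace ℝ (Fin n₂) →ₗ[ℝ] EuclideanSpace ℝ (Fin p))
    (c : EuclideanSpace ℝ (Fin p))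
    (hf : ∀ x, f x ≠ ⊥) (hg : ∀ z, g z ≠ ⊥)
    (φ₁ φ₂ : EuclideanSpace ℝ (Fin p) → EReal)
    (hφ₁ : φ₁ = AADR.imageFun A f)
    (hφ₂ : φ₂ = fun w => AADR.imageFun B g (w - c))
    (L σ γ ν₁ ν₂ : ℝ)
    -- `φ₁` is `L`-smooth and `σ`-hypoconvex
    (hL : AADR.LSmooth L φ₁) (hσ : AADR.Hypoconvex σ φ₁) (hσL : σ ∈ Set.Icc (-L) L)
    -- `φ₂` is lower semicontinuous and proper
    (hlsc : LowerSemicontinuous φ₂) (hprop : AADR.IsProper φ₂)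
    -- `min φ₁ + φ₂` has a solution, and `φ₁ + φ₂` is level-bounded
    (hsol : (AADR.argminSet fun w => φ₁ w + φ₂ w).Nonempty)
    (hlev : AADR.LevelBounded fun w => φ₁ w + φ₂ w)
    -- `0 < γ < min {1 / (2 max {-σ, 0}), 1 / L}`, where `1 / 0 = ∞`
    (hγ : 0 < γ) (hγσ : γ * (2 * max (-σ) 0) < 1) (hγL : γ * L < 1)
    (hν₁ : 0 < ν₁) (hν₂ : 0 < ν₂)
    (m : ℕ) (s u v sAA : ℕ → EuclideanSpace ℝ (Fin p))
    (x : ℕ → EuclideanSpace ℝ (Fin n₁)) (z : ℕ → EuclideanSpace ℝ (Fin n₂))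
    (hrun : AADR.IsAARun f g A B c γ ν₁ ν₂ m s u v sAA x z)
    -- the KL property with exponent `θ` at every cluster point of the iterates
    (θ : ℝ) (hθ : θ ∈ Set.Ioc (0 : ℝ) (1 / 2))
    (hKL : ∀ t : PiLp 2 (fun _ : Fin 3 => EuclideanSpace ℝ (Fin p)),
      MapClusterPt t atTop (fun k => WithLp.toLp 2 ![s k, u k, v k]) →
        AADR.HasKLExponentAt (AADR.drLyapunov γ φ₁ φ₂) t θ) :
    AADR.RLinearlyConvergesTo (fun k => ‖v k - u k‖) 0 ∧
      ∃ sStar uStar : EuclideanSpace ℝ (Fin p),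
        AADR.RLinearlyConvergesTo s sStar ∧
        AADR.RLinearlyConvergesTo u uStar ∧
        AADR.RLinearlyConvergesTo v uStar ∧
        sStar ∈ AADR.drMap γ φ₁ φ₂ sStar ∧
        AADR.proxMap γ φ₁ sStar = {uStar} := by
  open AADR in
  have hbot := hprop.1
  obtain ⟨φ, hφ⟩ : ∃ φ : EuclideanSpace ℝ (Fin p) → ℝ, φ₁ = fun x => (φ x : EReal) :=
    ⟨fun x => (φ₁ x).toReal, funext fun x => (EReal.coe_toReal (hL.1.1 x).2 (hL.1.1 x).1).symm⟩
  obtain ⟨⟨-, hdiff⟩, hLip⟩ := hL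
  obtain ⟨-, hσ⟩ := hσ
  simp only [hφ, EReal.toReal_coe, egradient] at hdiff hLip hσ
  have hG : ∀ x, HasGradientAt φ (gradient φ x) x := fun x => (hdiff x).hasGradientAt
  have hL0 : 0 ≤ L := by linarith [hσL.1, hσL.2]
  have hγσ' : 0 < 1 + γ * σ := by
    have := mul_le_mul_of_nonneg_left hσL.1 hγ.le
    linarith
  have hu : ∀ k, s k = u k + γ • gradient φ (u k) := fun k =>
    (mem_proxMap_coe_iff hG hσ hγ hγσ').1 (hφ ▸ hφ₁ ▸ hrun.u_mem_proxMap k)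
  have hv : ∀ k, v k ∈ proxMap γ φ₂ ((2 : ℝ) • u k - s k) := fun k =>
    hφ₂ ▸ hrun.v_mem_proxMap k
  choose b hb using fun k => exists_coe_eq_of_mem_proxMap hprop (hv k)
  obtain ⟨κ, hκ, hdec⟩ := hrun.exists_decrease (hφ₁ ▸ hφ) hφ₂.symm hbot hG hL0 hLip hσ hγ hγσ hγL
    hγσ' hν₁ hν₂ hb
  obtain ⟨l₀, hl₀⟩ : ∃ l₀ : ℝ, ∀ w (r : ℝ), φ₂ w = r → l₀ ≤ φ w + r := by
    obtain ⟨w₀, hw₀⟩ := hsol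
    have h1 := hw₀ (v 0)
    simp only [hφ, hb 0] at h1
    have hfin : φ₂ w₀ ≠ ⊤ := fun h => by
      rw [h, EReal.coe_add_top, top_le_iff] at h1
      exact EReal.add_ne_top (EReal.coe_ne_top _) (EReal.coe_ne_top _) h1
    refine ⟨φ w₀ + (φ₂ w₀).toReal, fun w r hr => ?_⟩
    have h2 := hw₀ w
    simp only [hφ, hr] at h2
    rw [← EReal.coe_toReal hfin (hbot w₀)] at h2
    exact_mod_cast h2
  rw [hφ] at hlev hKL ⊢
  obtain ⟨hr, s', u', hs', hu', hv', hstat, hprox⟩ := rLinearlyConvergesTo_of_decrease hG hL0 hLip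
    hσ hγ hγL hγσ' hlsc hbot hl₀ hlev hu hv hb hκ hdec hθ hKL
  exact ⟨hr, s', u', hs', hu', hv',
    ⟨u', (mem_proxMap_coe_iff hG hσ hγ hγσ').2 hstat, u', hprox, by abel⟩,
    proxMap_coe_eq_singleton hG hσ hγ hγσ' hstat⟩
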